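/- **Setting.** All quantum systems are finite-dimensional with fixed orthonormal bases, $d_Z\ge 1$ denotes the dimension of system $Z$, transposes are taken in these bases, and $\mathbb A,\mathbb X,\mathbb A',\mathbb X'$ are finite nonempty sets. A *channel assemblage* $\mathbf I_{\mathbb A|\mathbb X}=\{\mathcal I_{a|x}\}_{a\in\mathbb A,x\in\mathbb X}$ from $B_{in}$ to $B_{out}$ is a family of completely positive maps such that $\sum_a\mathcal I_{a|x}$ is one and the same CPTP map for all $x$, and such that $\operatorname{tr}\mathcal I_{a|x}(\rho)=p(a|x)$ is the same for all normalised states $\rho$ of $B_{in}$. Let $\mathbf I_{\mathbb A|\mathbb X}$ be a channel assemblage from $B_{in}$ to $B_{out}$ and $\mathbf I'_{\mathbb A'|\mathbb X'}$ a channel assemblage from $B'_{in'}$ to $B'_{out'}$. We write $\mathbf I_{\mathbb A|\mathbb X}\overset{\mathrm{LOSR}}{\longrightarrow}\mathbf I'_{\mathbb A'|\mathbb X'}$ if there exist a discrete (finite or countable) random variable $\lambda$ with distribution $p(\lambda)$; for each $\lambda$ a conditional distribution $p(a',x|a,x',\lambda)$ whose marginal $\sum_{a'}p(a',x|a,x',\lambda)$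 does not depend on $a$ (no retrocausation); a finite-dimensional system $S$; and for each $\lambda$ CPTP maps $\Lambda_\lambda^{B'_{in'}\to B_{in}S}$ and $\Lambda_\lambda^{B_{out}S\to B'_{out'}}$, such that for all $a'\in\mathbb A'$, $x'\in\mathbb X'$ $$\mathcal I'_{a'|x'}(\cdot)=\sum_\lambda\sum_{a,x}p(\lambda)\,p(a',x|a,x',\lambda)\;\Lambda_\lambda^{B_{out}S\to B'_{out'}}\,(\mathcal I_{a|x}\otimes \mathrm{id}_S)\,\Lambda_\lambda^{B'_{in'}\to B_{in}S}(\cdot).$$ The Choi operator of a map $\mathcal E$ with input system $Z$ is $(\mathcal E\otimes\mathrm{id})(|\Omega\rangle\langle\Omega|)$ with $|\Omega\rangle=d_Z^{-1/2}\sum_i|ii\rangle$; let $J_{a|x}$ and $J'_{a'|x'}$ be the Choi operators of $\mathcal I_{a|x}$ and $\mathcal I'_{a'|x'}$. For an operator $J$ on $B_{in}B_{out}$ and an operator $K$ on $B_{in}B'_{in'}B_{out}B'_{out'}$ define the link product $$J*K=d_{B_{in}}d_{B_{out}}\operatorname{tr}_{B_{in}B_{out}}\!\big[(\mathbb I_{B'_{in'}B'_{out'}}\otimes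 J^{T_{B_{out}}})\,K^{T_{B_{in}}}\big].$$ In the program below, $\lambda$ ranges over the $|\mathbb A'|^{|\mathbb A||\mathbb X'|}\,|\mathbb X|^{|\mathbb X'|}$ deterministic strategies, i.e. pairs of functions $f_\lambda:\mathbb A\times\mathbb X'\to\mathbb A'$ and $g_\lambda:\mathbb X'\to\mathbb X$, and $D(a'|a,x',\lambda)=\delta_{a',f_\lambda(a,x')}$, $D(x|x',\lambda)=\delta_{x,g_\lambda(x')}$. **Statement.** $\mathbf I_{\mathbb A|\mathbb X}\overset{\mathrm{LOSR}}{\longrightarrow}\mathbf I'_{\mathbb A'|\mathbb X'}$ if and only if the following SDP is feasible: there are operators $J_{\xi\lambda}$ on $B_{in}B'_{in'}B_{out}B'_{out'}$ and $J_{F\lambda}$ on $B_{in}B'_{in'}$ such that $$\begin{cases} J_{\xi\lambda}\ge 0 & \forall\lambda,\\ \operatorname{tr}_{B'_{out'}B_{in}}J_{\xi\lambda}\propto\mathbb I_{B_{out}B'_{in'}} & \forall\lambda,\\ \sum_\lambda\operatorname{tr}_{B'_{out'}B_{in}}J_{\xi\lambda}=\frac1{d_{B_{out}}d_{B'_{in'}}}\mathbb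 I_{B_{out}B'_{in'}},\\ J_{F\lambda}\ge 0 & \forall\lambda,\\ \operatorname{tr}_{B_{in}}J_{F\lambda}\propto\mathbb I_{B'_{in'}} & \forall\lambda,\\ \sum_\lambda\operatorname{tr}_{B_{in}}J_{F\lambda}=\frac1{d_{B'_{in'}}}\mathbb I_{B'_{in'}},\\ \operatorname{tr}_{B'_{out'}}J_{\xi\lambda}=J_{F\lambda}\otimes\frac1{d_{B_{out}}}\mathbb I_{B_{out}} & \forall\lambda,\\ J'_{a'|x'}=\sum_\lambda\sum_{a,x}D(a'|a,x',\lambda)\,D(x|x',\lambda)\;J_{a|x}*J_{\xi\lambda} & \forall a'\in\mathbb A',\,x'\in\mathbb X', \end{cases}$$ where $\propto$ means equality up to a scalar factor, which may be zero. -/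

import Mathlib

noncomputable section

open Matrix
open scoped Kronecker ComplexOrder

namespace ChannelEPR

section Systems

variable {n m : Type*}

/-- The ampliation `Φ ⊗ id_S` of a linear map `Φ` between matrix algebras: `Φ` is applied to each
block `(M_{(i,s),(j,t)})_{i,j}` of a matrix `M` on the composite system. -/
def ampl (S : Type*) (Φ : Matrix n n ℂ →ₗ[ℂ] Matrix m m ℂ) :
    Matrix (n × S) (n × S) ℂ →ₗ[ℂ] Matrix (m × S) (m × S) ℂ where
  toFun M := Matrix.of fun p q => Φ (Matrix.of fun i j => M (i, p.2) (j, q.2)) p.1 q.1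
  map_add' M N := by
    ext p q
    exact congrFun (congrFun (Φ.map_add (Matrix.of fun i j => M (i, p.2) (j, q.2))
      (Matrix.of fun i j => N (i, p.2) (j, q.2))) p.1) q.1
  map_smul' c M := by
    ext p q
    exact congrFun (congrFun (Φ.map_smul c (Matrix.of fun i j => M (i, p.2) (j, q.2))) p.1) q.1

/-- Complete positivity: `Φ ⊗ id_k` preserves positive semidefiniteness for all `k`. -/
def IsCP (Φ : Matrix n n ℂ →ₗ[ℂ] Matrix m m ℂ) : Prop :=
  ∀ (k : ℕ) (M : Matrix (n × Fin k) (n × Fin k) ℂ), M.PosSemidef → (ampl (Fin k) Φ M).PosSemidef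

/-- Quantum channels: completely positive and trace-preserving maps. -/
def IsCPTP [Fintype n] [Fintype m] (Φ : Matrix n n ℂ →ₗ[ℂ] Matrix m m ℂ) : Prop :=
  IsCP Φ ∧ ∀ M : Matrix n n ℂ, (Φ M).trace = M.trace

/-- Normalised states (density operators). -/
def IsState [Fintype n] (ρ : Matrix n n ℂ) : Prop :=
  ρ.PosSemidef ∧ ρ.trace = 1

/-- The vector `|Ω⟩ = d^{-1/2} ∑ᵢ |i i⟩`. -/
def maxEntKet (n : Type*) [Fintype n] [DecidableEq n] : n × n → ℂ :=
  fun p => if p.1 = p.2 then (((Real.sqrt (Fintype.card n))⁻¹ : ℝ) : ℂ) else 0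

/-- The (normalised) Choi operator `(Φ ⊗ id) |Ω⟩⟨Ω|`; the first tensor factor is the output
system and the second one is the input system. -/
def choi [Fintype n] [DecidableEq n] (Φ : Matrix n n ℂ →ₗ[ℂ] Matrix m m ℂ) :
    Matrix (m × n) (m × n) ℂ :=
  ampl n Φ (Matrix.vecMulVec (maxEntKet n) (star (maxEntKet n)))

/-- Partial trace over the first factor. -/
def traceFst [Fintype n] (M : Matrix (n × m) (n × m) ℂ) : Matrix m m ℂ :=
  Matrix.of fun i j => ∑ k, M (k, i) (k, j)

/-- Partial trace over the second factor. -/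
def traceSnd [Fintype m] (M : Matrix (n × m) (n × m) ℂ) : Matrix n n ℂ :=
  Matrix.of fun i j => ∑ k, M (i, k) (j, k)

/-- Partial transpose on the first factor. -/
def transposeFst (M : Matrix (n × m) (n × m) ℂ) : Matrix (n × m) (n × m) ℂ :=
  Matrix.of fun p q => M (q.1, p.2) (p.1, q.2)

end Systems

section Assemblages

variable {A X Bi Bo : Type*} [Fintype A] [Fintype Bi] [Fintype Bo]

/-- Channel assemblages `{𝓘_{a|x}}`: instruments (families of completely positive maps summing
to a channel), where the channel `∑ₐ 𝓘_{a|x}` does not depend on `x`, and the probability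
`p(a|x) = tr 𝓘_{a|x}(ρ)` of Alice's outcome does not depend on Bob's input state `ρ`. -/
structure IsChannelAssemblage (I : A → X → Matrix Bi Bi ℂ →ₗ[ℂ] Matrix Bo Bo ℂ) : Prop where
  cp : ∀ a x, IsCP (I a x)
  sum_channel : ∃ L : Matrix Bi Bi ℂ →ₗ[ℂ] Matrix Bo Bo ℂ, IsCPTP L ∧ ∀ x, ∑ a, I a x = L
  prob : ∃ p : A → X → ℝ, ∀ a x (ρ : Matrix Bi Bi ℂ), IsState ρ → (I a x ρ).trace = (p a x : ℂ)

end Assemblages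

section LOSR

/-- A local operation of Alice and Bob assisted by shared randomness, from assemblages with
outcomes `A`, settings `X` and Bob's systems `Bi → Bo` to assemblages with outcomes `A'`,
settings `X'` and Bob's systems `Bi' → Bo'`. -/
structure LOSROperation (A X A' X' Bi Bo Bi' Bo' : Type*) [Fintype X] [Fintype A']
    [Fintype Bi] [Fintype Bo] [Fintype Bi'] [Fintype Bo'] where
  /-- Values of the shared classical random variable, which is discrete. -/
  Lam : Type
  countable_Lam : Countable Lam
  /-- The distribution `p(λ)` of the shared variable. -/
  p : Lam → ℝ
  p_nonneg : ∀ l, 0 ≤ p l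
  p_sum : HasSum p 1
  /-- Alice's pre- and post-processing: `alice l a' x a x'` is `p(a', x | a, x', λ)`. -/
  alice : Lam → A' → X → A → X' → ℝ
  alice_nonneg : ∀ l a' x a x', 0 ≤ alice l a' x a x'
  alice_sum : ∀ l a x', ∑ a', ∑ x, alice l a' x a x' = 1
  /-- No retrocausation: `x` does not depend on `a`. -/
  alice_noRetro : ∀ l x x' a₁ a₂, ∑ a', alice l a' x a₁ x' = ∑ a', alice l a' x a₂ x'
  /-- The dimension of the side channel `S` of Bob. -/
  dimS : ℕ
  /-- Bob's pre-processing `B'_{in'} → B_in ⊗ S`. -/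
  pre : Lam → Matrix Bi' Bi' ℂ →ₗ[ℂ] Matrix (Bi × Fin dimS) (Bi × Fin dimS) ℂ
  pre_cptp : ∀ l, IsCPTP (pre l)
  /-- Bob's post-processing `B_out ⊗ S → B'_{out'}`. -/
  post : Lam → Matrix (Bo × Fin dimS) (Bo × Fin dimS) ℂ →ₗ[ℂ] Matrix Bo' Bo' ℂ
  post_cptp : ∀ l, IsCPTP (post l)

variable {A X A' X' Bi Bo Bi' Bo' : Type*} [Fintype A] [Fintype X] [Fintype A']
  [Fintype Bi] [Fintype Bo] [Fintype Bi'] [Fintype Bo']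

/-- The operation transforms the family `I` into the family `I'`:
`𝓘'_{a'|x'}(ρ) = ∑_λ ∑_{a,x} p(λ) p(a',x|a,x',λ) post_λ ((𝓘_{a|x} ⊗ id_S) (pre_λ ρ))`. -/
def LOSROperation.Transforms (T : LOSROperation A X A' X' Bi Bo Bi' Bo')
    (I : A → X → Matrix Bi Bi ℂ →ₗ[ℂ] Matrix Bo Bo ℂ)
    (I' : A' → X' → Matrix Bi' Bi' ℂ →ₗ[ℂ] Matrix Bo' Bo' ℂ) : Prop :=
  ∀ a' x' (ρ : Matrix Bi' Bi' ℂ),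
    HasSum (fun l => ∑ a, ∑ x, ((T.p l * T.alice l a' x a x' : ℝ) : ℂ) •
      T.post l (ampl (Fin T.dimS) (I a x) (T.pre l ρ))) (I' a' x' ρ)

/-- `I` can be converted into `I'` under LOSR operations. -/
def LOSRConvertible (I : A → X → Matrix Bi Bi ℂ →ₗ[ℂ] Matrix Bo Bo ℂ)
    (I' : A' → X' → Matrix Bi' Bi' ℂ →ₗ[ℂ] Matrix Bo' Bo' ℂ) : Prop :=
  ∃ T : LOSROperation A X A' X' Bi Bo Bi' Bo', T.Transforms I I'

end LOSR

section SDP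

variable {A X A' X' Bi Bo Bi' Bo' : Type*}

/-- The deterministic strategies of Alice: a function `(a, x') ↦ a'` and a function `x' ↦ x`. -/
abbrev Strategy (A X A' X' : Type*) : Type _ := (A → X' → A') × (X' → X)

/-- The deterministic distribution `D(a' | a, x', λ)`. -/
def Strategy.dOut [DecidableEq A'] (l : Strategy A X A' X') (a' : A') (a : A) (x' : X') : ℂ :=
  if l.1 a x' = a' then 1 else 0

/-- The deterministic distribution `D(x | x', λ)`. -/
def Strategy.dIn [DecidableEq X] (l : Strategy A X A' X') (x : X) (x' : X') : ℂ :=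
  if l.2 x' = x then 1 else 0

/-- Operators on `B_in ⊗ B'_{in'} ⊗ B_out ⊗ B'_{out'}`. -/
abbrev CombOp (Bi Bi' Bo Bo' : Type*) : Type _ :=
  Matrix (((Bi × Bi') × Bo) × Bo') (((Bi × Bi') × Bo) × Bo') ℂ

/-- `tr_{B'_{out'} B_in} K`, an operator on `B'_{in'} ⊗ B_out`. -/
def traceOutputs [Fintype Bi] [Fintype Bo'] (K : CombOp Bi Bi' Bo Bo') :
    Matrix (Bi' × Bo) (Bi' × Bo) ℂ :=
  Matrix.of fun p q => ∑ s, traceSnd K ((s, p.1), p.2) ((s, q.1), q.2)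

/-- `tr_{B_in B_out} K`, an operator on `B'_{out'} ⊗ B'_{in'}`. -/
def traceInner [Fintype Bi] [Fintype Bo] (K : CombOp Bi Bi' Bo Bo') :
    Matrix (Bo' × Bi') (Bo' × Bi') ℂ :=
  Matrix.of fun p q => ∑ s, ∑ k, K (((s, p.2), k), p.1) (((s, q.2), k), q.1)

/-- `𝟙_{B'_{in'} B'_{out'}} ⊗ J` for an operator `J` on `B_out ⊗ B_in`. -/
def padInner [DecidableEq Bi'] [DecidableEq Bo'] (J : Matrix (Bo × Bi) (Bo × Bi) ℂ) :
    CombOp Bi Bi' Bo Bo' :=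
  Matrix.of fun p q =>
    (1 : Matrix (Bi' × Bo') (Bi' × Bo') ℂ) (p.1.1.2, p.2) (q.1.1.2, q.2) *
      J (p.1.2, p.1.1.1) (q.1.2, q.1.1.1)

/-- The partial transpose `K^{T_{B_in}}`. -/
def transposeBi (K : CombOp Bi Bi' Bo Bo') : CombOp Bi Bi' Bo Bo' :=
  Matrix.of fun p q => K (((q.1.1.1, p.1.1.2), p.1.2), p.2) (((p.1.1.1, q.1.1.2), q.1.2), q.2)

/-- The link product
`J * K = d_{B_in} d_{B_out} tr_{B_in B_out} ((𝟙_{B'_{in'} B'_{out'}} ⊗ J^{T_{B_out}}) K^{T_{B_in}})`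
of an operator `J` on `B_out ⊗ B_in` with an operator `K` on
`B_in ⊗ B'_{in'} ⊗ B_out ⊗ B'_{out'}`. -/
def link [Fintype Bi] [Fintype Bo] [Fintype Bi'] [Fintype Bo'] [DecidableEq Bi']
    [DecidableEq Bo'] (J : Matrix (Bo × Bi) (Bo × Bi) ℂ) (K : CombOp Bi Bi' Bo Bo') :
    Matrix (Bo' × Bi') (Bo' × Bi') ℂ :=
  ((Fintype.card Bi : ℂ) * (Fintype.card Bo : ℂ)) •
    traceInner (padInner (transposeFst J) * transposeBi K)

/-- The constraints of the semidefinite program, for data `J`, `J'` and unknowns `Jξ`, `JF`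
indexed by all deterministic strategies of Alice. -/
structure IsSDPSolution [Fintype A] [Fintype X] [Fintype A'] [Fintype X']
    [Fintype Bi] [Fintype Bo] [Fintype Bi'] [Fintype Bo'] [DecidableEq A] [DecidableEq X]
    [DecidableEq A'] [DecidableEq X'] [DecidableEq Bo] [DecidableEq Bi'] [DecidableEq Bo']
    (J : A → X → Matrix (Bo × Bi) (Bo × Bi) ℂ)
    (J' : A' → X' → Matrix (Bo' × Bi') (Bo' × Bi') ℂ)
    (Jξ : Strategy A X A' X' → CombOp Bi Bi' Bo Bo')
    (JF : Strategy A X A' X' → Matrix (Bi × Bi') (Bi × Bi') ℂ) : Prop where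
  ξ_pos : ∀ l, (Jξ l).PosSemidef
  ξ_prop : ∀ l, ∃ c : ℂ, traceOutputs (Jξ l) = c • (1 : Matrix (Bi' × Bo) (Bi' × Bo) ℂ)
  ξ_sum : ∑ l, traceOutputs (Jξ l) =
    (1 / ((Fintype.card Bo : ℂ) * (Fintype.card Bi' : ℂ))) • (1 : Matrix (Bi' × Bo) (Bi' × Bo) ℂ)
  F_pos : ∀ l, (JF l).PosSemidef
  F_prop : ∀ l, ∃ c : ℂ, traceFst (JF l) = c • (1 : Matrix Bi' Bi' ℂ)
  F_sum : ∑ l, traceFst (JF l) = (1 / (Fintype.card Bi' : ℂ)) • (1 : Matrix Bi' Bi' ℂ)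
  no_signalling : ∀ l, traceSnd (Jξ l) =
    JF l ⊗ₖ ((1 / (Fintype.card Bo : ℂ)) • (1 : Matrix Bo Bo ℂ))
  decomp : ∀ a' x', J' a' x' =
    ∑ l, ∑ a, ∑ x, (Strategy.dOut l a' a x' * Strategy.dIn l x x') • link (J a x) (Jξ l)

/-- Feasibility of the semidefinite program. -/
def SDPFeasible [Fintype A] [Fintype X] [Fintype A'] [Fintype X']
    [Fintype Bi] [Fintype Bo] [Fintype Bi'] [Fintype Bo'] [DecidableEq A] [DecidableEq X]
    [DecidableEq A'] [DecidableEq X'] [DecidableEq Bo] [DecidableEq Bi'] [DecidableEq Bo']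
    (J : A → X → Matrix (Bo × Bi) (Bo × Bi) ℂ)
    (J' : A' → X' → Matrix (Bo' × Bi') (Bo' × Bi') ℂ) : Prop :=
  ∃ (Jξ : Strategy A X A' X' → CombOp Bi Bi' Bo Bo')
    (JF : Strategy A X A' X' → Matrix (Bi × Bi') (Bi × Bi') ℂ), IsSDPSolution J J' Jξ JF

end SDP

end ChannelEPR

end

/-! Both sides describe probabilistic mixtures of pairs (deterministic strategy of Alice, quantum
comb of Bob). Bob's two channels joined by the memory S form a comb, whose Choi operator `combOp pre
post` is positive semidefinite with marginal on all systems but B'_out' of the form F ⊗ 𝟙/d.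
Inserting a map into the comb is the link product of the Choi operators (`link_choi_combOp`), so the
transformation law becomes the last equation of the program.

From LOSR to the program: absence of retrocausation lets Alice's conditional distribution be written
as p(x|x') p(a'|a,x',x), a mixture of deterministic strategies with weights w_t(s)
(`exists_strategy_weights`). With K_t the comb operator at shared value t, put J_ξs = ∑_t p(t)
w_t(s) K_t. The K_t are positive with unit trace, so the possibly infinite series converges; every
constraint is linear or closed, hence survives the sum.

From the program to LOSR: each J_ξs must be realised as a nonnegative multiple of a `combOp`
(`exists_smul_combOp`). After rescaling, the marginal is C ⊗ 𝟙 with C = R R†. The entries of R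
define an isometry B'_in' → B_in S, which purifies C, and conjugating the comb by a generalised
inverse G of R gives the Choi operator of the post-processing on the support of the memory; off the
support a fixed state is prepared. The scalar multiples sum to one and serve as the distribution of
the shared variable s. Injectivity of the Choi map then turns the equation for Choi operators into
one for maps. -/

noncomputable section

open Matrix
open scoped Kronecker ComplexOrder

namespace ChannelEPR

/-! ### Mixtures of deterministic strategies -/

section Strategies

/-- The expectation of a function of one coordinate under a product distribution. -/
lemma sum_prod_mul_coord {ι κ : Type*} [Fintype ι] [DecidableEq ι] [Fintype κ]
    (q : ι → κ → ℝ) (hq : ∀ i, ∑ k, q i k = 1) (i₀ : ι) (φ : κ → ℝ) :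
    ∑ g : ι → κ, (∏ i, q i (g i)) * φ (g i₀) = ∑ k, q i₀ k * φ k := by
  classical
  -- Absorbing φ into the factor at i₀ keeps the summand a product over coordinates, so the sum
  -- factorises.
  have h1 : ∀ g : ι → κ, (∏ i, q i (g i)) * φ (g i₀) =
      ∏ i, (q i (g i) * if i = i₀ then φ (g i) else 1) := by
    intro g
    rw [Finset.prod_mul_distrib, Finset.prod_ite_eq' Finset.univ i₀ (fun i => φ (g i))]
    simp
  simp_rw [h1]
  rw [← Fintype.prod_sum (fun i k => q i k * if i = i₀ then φ k else 1)]
  rw [Finset.prod_eq_single i₀]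
  · simp
  · intro i _ hi
    simp [hi, hq]
  · simp

/-- A product distribution is normalised. -/
lemma sum_prod_eq_one {ι κ : Type*} [Fintype ι] [DecidableEq ι] [Fintype κ]
    (q : ι → κ → ℝ) (hq : ∀ i, ∑ k, q i k = 1) :
    ∑ g : ι → κ, ∏ i, q i (g i) = 1 := by
  rw [← Fintype.prod_sum]
  simp [hq]

/-- A conditional distribution without retrocausation is a mixture of deterministic strategies. -/
lemma exists_strategy_weights {A X A' X' : Type*} [Fintype A] [DecidableEq A] [Nonempty A]
    [Fintype X] [DecidableEq X] [Fintype A'] [DecidableEq A'] [Nonempty A']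
    [Fintype X'] [DecidableEq X']
    (P : A' → X → A → X' → ℝ) (hP : ∀ a' x a x', 0 ≤ P a' x a x')
    (hsum : ∀ a x', ∑ a', ∑ x, P a' x a x' = 1)
    (hretro : ∀ x x' a₁ a₂, ∑ a', P a' x a₁ x' = ∑ a', P a' x a₂ x') :
    ∃ w : Strategy A X A' X' → ℝ, (∀ s, 0 ≤ w s) ∧ ∑ s, w s = 1 ∧
      ∀ a' x a x', ∑ s : Strategy A X A' X',
        w s * ((if s.1 a x' = a' then 1 else 0) * (if s.2 x' = x then 1 else 0)) = P a' x a x' := by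
  obtain ⟨a₀⟩ := ‹Nonempty A›
  set p : X' → X → ℝ := fun x' x => ∑ a', P a' x a₀ x' with hp
  have hp0 : ∀ x' x, 0 ≤ p x' x := fun x' x => Finset.sum_nonneg fun a' _ => hP _ _ _ _
  have hp1 : ∀ x', ∑ x, p x' x = 1 := fun x' => by
    rw [hp, Finset.sum_comm]; exact hsum a₀ x'
  -- This is p(a'|a,x',x). Where p(x|x') = 0 the uniform value keeps it normalised.
  set r : A → X' → X → A' → ℝ := fun a x' x a' =>
    if p x' x = 0 then (Fintype.card A' : ℝ)⁻¹ else P a' x a x' / p x' x with hr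
  have hr0 : ∀ a x' x a', 0 ≤ r a x' x a' := fun a x' x a' => by
    rw [hr]; dsimp only; split_ifs
    · positivity
    · exact div_nonneg (hP _ _ _ _) (hp0 _ _)
  have hr1 : ∀ a x' x, ∑ a', r a x' x a' = 1 := fun a x' x => by
    rw [hr]; dsimp only; split_ifs with h
    · simp
    · rw [← Finset.sum_div, hretro x x' a a₀]
      exact div_self h
  have hpr : ∀ a x' x a', p x' x * r a x' x a' = P a' x a x' := fun a x' x a' => by
    by_cases h : p x' x = 0
    · rw [h, zero_mul]
      -- The marginal was defined with a₀; no retrocausation makes it vanish for a too, hence every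
      -- nonnegative term vanishes.
      have h2 : ∑ a', P a' x a x' = 0 := (hretro x x' a a₀).trans h
      exact ((Finset.sum_eq_zero_iff_of_nonneg fun a' _ => hP a' x a x').1 h2 a'
        (Finset.mem_univ _)).symm
    · rw [hr]; dsimp only; rw [if_neg h]; field_simp
  clear_value p r
  -- Draw the values g x' independently from p; given g, draw the values f a x' independently from r
  -- at x = g x'.
  refine ⟨fun s => (∏ x', p x' (s.2 x')) * ∏ a, ∏ x', r a x' (s.2 x') (s.1 a x'),
    fun s => ?_, ?_, fun a' x a x' => ?_⟩
  · exact mul_nonneg (Finset.prod_nonneg fun _ _ => hp0 _ _)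
      (Finset.prod_nonneg fun _ _ => Finset.prod_nonneg fun _ _ => hr0 _ _ _ _)
  · rw [Fintype.sum_prod_type_right]
    simp_rw [← Finset.mul_sum]
    have h : ∀ g : X' → X, ∑ f : A → X' → A', ∏ a, ∏ x', r a x' (g x') (f a x') = 1 := fun g => by
      have h1 : ∀ a, ∑ h : X' → A', ∏ x', r a x' (g x') (h x') = 1 := fun a => by
        have := sum_prod_eq_one (fun x' => r a x' (g x')) fun x' => hr1 _ _ _
        exact this
      have := sum_prod_eq_one (fun a (h : X' → A') => ∏ x', r a x' (g x') (h x')) h1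
      exact this
    simp_rw [h, mul_one]
    exact sum_prod_eq_one p hp1
  · rw [Fintype.sum_prod_type_right]
    have h : ∀ g : X' → X, ∑ f : A → X' → A',
        (∏ a, ∏ x', r a x' (g x') (f a x')) * (if f a x' = a' then 1 else 0) =
          r a x' (g x') a' := fun g => by
      have h1 : ∀ a, ∑ h : X' → A', ∏ x', r a x' (g x') (h x') = 1 := fun a => by
        have := sum_prod_eq_one (fun x' => r a x' (g x')) fun x' => hr1 _ _ _
        exact this
      have h2 := sum_prod_mul_coord (fun a (h : X' → A') => ∏ x', r a x' (g x') (h x')) h1 a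
        (fun h => if h x' = a' then 1 else 0)
      rw [h2]
      rw [sum_prod_mul_coord (fun x' k => r a x' (g x') k) (fun x' => hr1 _ _ _) x'
        (fun k => if k = a' then 1 else 0)]
      simp
    calc _ = ∑ g : X' → X, (∏ x', p x' (g x')) * ((if g x' = x then 1 else 0) *
          ∑ f : A → X' → A',
            (∏ a, ∏ x', r a x' (g x') (f a x')) * (if f a x' = a' then 1 else 0)) := by
          refine Finset.sum_congr rfl fun g _ => ?_
          rw [Finset.mul_sum, Finset.mul_sum]
          refine Finset.sum_congr rfl fun f _ => ?_
          ring
      _ = ∑ g : X' → X, (∏ x', p x' (g x')) *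
          (fun k => (if k = x then 1 else 0) * r a x' k a') (g x') := by
          simp_rw [h]
      _ = P a' x a x' := by
          rw [sum_prod_mul_coord p hp1 x' (fun k => (if k = x then 1 else 0) * r a x' k a')]
          simp [hpr]

end Strategies

/-! ### Choi operators, kernels and complete positivity -/

section Maps

variable {n m S : Type*}

lemma ampl_apply (Φ : Matrix n n ℂ →ₗ[ℂ] Matrix m m ℂ) (M : Matrix (n × S) (n × S) ℂ)
    (p q : m × S) :
    ampl S Φ M p q = Φ (Matrix.of fun i j => M (i, p.2) (j, q.2)) p.1 q.1 := rfl

/-- Complete positivity for ancillas indexed by an arbitrary finite type. -/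
lemma IsCP.posSemidef_ampl [Fintype S] {Φ : Matrix n n ℂ →ₗ[ℂ] Matrix m m ℂ} (hΦ : IsCP Φ)
    {M : Matrix (n × S) (n × S) ℂ} (hM : M.PosSemidef) : (ampl S Φ M).PosSemidef := by
  let e := Fintype.equivFin S
  have h := (hΦ (Fintype.card S) _ (hM.submatrix (Prod.map id e.symm))).submatrix (Prod.map id e)
  convert h using 1
  ext p q
  simp [ampl_apply]

/-- For fixed ancilla indices, the block of |Ω⟩⟨Ω| is a matrix unit divided by the dimension. -/
lemma choi_apply [Fintype n] [DecidableEq n] (Φ : Matrix n n ℂ →ₗ[ℂ] Matrix m m ℂ)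
    (p q : m × n) :
    choi Φ p q = (1 / (Fintype.card n : ℂ)) * Φ (Matrix.single p.2 q.2 1) p.1 q.1 := by
  have h : (Matrix.of fun i j =>
      Matrix.vecMulVec (maxEntKet n) (star (maxEntKet n)) (i, p.2) (j, q.2)) =
      (1 / (Fintype.card n : ℂ)) • Matrix.single p.2 q.2 (1 : ℂ) := by
    ext i j
    have hs : (((Real.sqrt (Fintype.card n))⁻¹ : ℝ) : ℂ) * (((Real.sqrt (Fintype.card n))⁻¹ : ℝ) : ℂ)
        = 1 / (Fintype.card n : ℂ) := by
      rw [← Complex.ofReal_mul, ← mul_inv, Real.mul_self_sqrt (by positivity)]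
      simp
    simp only [Matrix.of_apply, Matrix.vecMulVec_apply, maxEntKet, Pi.star_apply,
      Matrix.smul_apply, Matrix.single_apply, smul_eq_mul]
    by_cases h1 : i = p.2 <;> by_cases h2 : j = q.2
    · simpa [h1, h2] using hs
    · simp [h1, h2, Ne.symm h2]
    · simp [h1, Ne.symm h1]
    · simp [h1, Ne.symm h1]
  rw [choi, ampl_apply, h, map_smul, Matrix.smul_apply, smul_eq_mul]

/-- A linear map between matrix algebras in terms of the matrix units. -/
lemma map_eq_sum_single [Fintype n] [DecidableEq n] (Φ : Matrix n n ℂ →ₗ[ℂ] Matrix m m ℂ)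
    (M : Matrix n n ℂ) : Φ M = ∑ i, ∑ j, M i j • Φ (Matrix.single i j 1) := by
  conv_lhs => rw [Matrix.matrix_eq_sum_single M]
  simp only [map_sum, ← map_smul, Matrix.smul_single, smul_eq_mul, mul_one]

/-- The linear map with kernel `Q`, an operator on input and output. -/
def kernelMap [Fintype n] (Q : Matrix (n × m) (n × m) ℂ) :
    Matrix n n ℂ →ₗ[ℂ] Matrix m m ℂ where
  toFun M := Matrix.of fun b c => ∑ i, ∑ j, M i j * Q (i, b) (j, c)
  map_add' M N := by
    ext b c
    simp [add_mul, Finset.sum_add_distrib]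
  map_smul' r M := by
    ext b c
    simp [Finset.mul_sum, mul_assoc]

lemma kernelMap_apply [Fintype n] (Q : Matrix (n × m) (n × m) ℂ) (M : Matrix n n ℂ) (b c : m) :
    kernelMap Q M b c = ∑ i, ∑ j, M i j * Q (i, b) (j, c) := rfl

/-- The ampliated image of M is W (M ⊗ Q) W†, where W contracts the input index of M with that of Q.
-/
lemma isCP_kernelMap [Fintype n] [Fintype m] {Q : Matrix (n × m) (n × m) ℂ}
    (hQ : Q.PosSemidef) : IsCP (kernelMap Q) := by
  classical
  intro k M hM
  have hMQ := hM.kronecker hQ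
  let W : Matrix (m × Fin k) ((n × Fin k) × (n × m)) ℂ := Matrix.of fun p r =>
    if r = ((r.2.1, p.2), (r.2.1, p.1)) then 1 else 0
  have h := hMQ.mul_mul_conjTranspose_same W
  have hW : ∀ (p : m × Fin k) (φ : (n × Fin k) × (n × m) → ℂ),
      ∑ r, W p r * φ r = ∑ i, φ ((i, p.2), (i, p.1)) := by
    intro p φ
    simp only [W, Matrix.of_apply, Fintype.sum_prod_type, Prod.mk.injEq, ite_mul, one_mul,
      zero_mul, ite_and, true_and]
    refine Finset.sum_congr rfl fun i _ => ?_
    simp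
  refine (congrArg Matrix.PosSemidef ?_).mp h
  ext p q
  rw [Matrix.mul_apply]
  have h2 : ∀ r, (W * (M ⊗ₖ Q)) p r * Wᴴ r q = W q r * (∑ i, (M ⊗ₖ Q) ((i, p.2), (i, p.1)) r) := by
    intro r
    rw [mul_comm, Matrix.mul_apply, hW p (fun r' => (M ⊗ₖ Q) r' r)]
    simp [W, Matrix.conjTranspose_apply]
  simp_rw [h2]
  rw [hW q (fun r => ∑ i, (M ⊗ₖ Q) ((i, p.2), (i, p.1)) r), Finset.sum_comm]
  rfl

lemma isCPTP_kernelMap [Fintype n] [Fintype m] [DecidableEq n] {Q : Matrix (n × m) (n × m) ℂ}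
    (hQ : Q.PosSemidef) (h1 : traceSnd Q = 1) : IsCPTP (kernelMap Q) := by
  refine ⟨isCP_kernelMap hQ, fun M => ?_⟩
  simp only [Matrix.trace, Matrix.diag_apply, kernelMap_apply]
  rw [Finset.sum_comm]
  refine Finset.sum_congr rfl fun i _ => ?_
  rw [Finset.sum_comm]
  have h : ∀ j, ∑ b, M i j * Q (i, b) (j, b) = M i j * (1 : Matrix n n ℂ) i j := fun j => by
    rw [← Finset.mul_sum, ← h1]; rfl
  simp [h, Matrix.one_apply]

/-- Discard the input and prepare a basis state. Such channels fill in for strategies of weight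
zero. -/
lemma exists_isCPTP [Fintype n] [Fintype m] [Nonempty m] :
    ∃ Φ : Matrix n n ℂ →ₗ[ℂ] Matrix m m ℂ, IsCPTP Φ := by
  classical
  obtain ⟨b₀⟩ := ‹Nonempty m›
  refine ⟨kernelMap (Matrix.diagonal fun p : n × m => if p.2 = b₀ then 1 else 0),
    isCPTP_kernelMap (Matrix.PosSemidef.diagonal fun p => ?_) ?_⟩
  · dsimp only [Pi.zero_apply]
    split_ifs
    · exact zero_le_one
    · exact le_rfl
  · ext i j
    by_cases h : i = j
    · subst h
      simp [traceSnd]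
    · simp [traceSnd, Matrix.diagonal_apply, h]

end Maps

/-! ### Choi operators of combs and their marginals -/

section Combs

/-- The trace condition on the operator of a comb in terms of its marginal. -/
lemma traceOutputs_of_traceSnd {Bi Bo Bi' Bo' : Type*} [DecidableEq Bo] [DecidableEq Bi']
    [Fintype Bi] [Fintype Bo'] {K : CombOp Bi Bi' Bo Bo'}
    {F : Matrix (Bi × Bi') (Bi × Bi') ℂ} {c d : ℂ}
    (hK : traceSnd K = F ⊗ₖ (d • (1 : Matrix Bo Bo ℂ))) (hF : traceFst F = c • 1) :
    traceOutputs K = (c * d) • (1 : Matrix (Bi' × Bo) (Bi' × Bo) ℂ) := by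
  ext p q
  have h := congrFun (congrFun hF p.1) q.1
  simp only [traceFst, Matrix.of_apply, Matrix.smul_apply, smul_eq_mul] at h
  simp only [traceOutputs, hK, Matrix.of_apply, Matrix.kroneckerMap_apply, Matrix.smul_apply,
    smul_eq_mul, ← Finset.sum_mul, h]
  rw [← Matrix.one_kronecker_one, Matrix.kroneckerMap_apply]
  ring

variable {Bi Bo Bi' Bo' S : Type*} [Fintype Bo] [Fintype Bi'] [DecidableEq Bo] [DecidableEq Bi']

/-- The normalised Choi operator of the comb which consists of a map `pre` into `B_in ⊗ S` and a
map `post` from `B_out ⊗ S`. -/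
def combOp (pre : Matrix Bi' Bi' ℂ →ₗ[ℂ] Matrix (Bi × S) (Bi × S) ℂ)
    (post : Matrix (Bo × S) (Bo × S) ℂ →ₗ[ℂ] Matrix Bo' Bo' ℂ) : CombOp Bi Bi' Bo Bo' :=
  Matrix.of fun p q => (1 / ((Fintype.card Bo : ℂ) * (Fintype.card Bi' : ℂ))) *
    post (Matrix.of fun u v => Matrix.single p.1.2 q.1.2 (1 : ℂ) u.1 v.1 *
      pre (Matrix.single p.1.1.2 q.1.1.2 1) (p.1.1.1, u.2) (q.1.1.1, v.2)) p.2 q.2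

/-- The normalised Choi operator of the reduction of `pre` to `B_in`. -/
def combMarginal [Fintype S] (pre : Matrix Bi' Bi' ℂ →ₗ[ℂ] Matrix (Bi × S) (Bi × S) ℂ) :
    Matrix (Bi × Bi') (Bi × Bi') ℂ :=
  Matrix.of fun p q => (1 / (Fintype.card Bi' : ℂ)) *
    ∑ t, pre (Matrix.single p.2 q.2 1) (p.1, t) (q.1, t)

/-- Tracing out the output of a trace-preserving `post` traces out its input instead: the B_out
matrix unit gives the identity entry, and the memory is traced out of `pre`. -/
lemma traceSnd_combOp [Fintype S] [Fintype Bo']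
    (pre : Matrix Bi' Bi' ℂ →ₗ[ℂ] Matrix (Bi × S) (Bi × S) ℂ)
    {post : Matrix (Bo × S) (Bo × S) ℂ →ₗ[ℂ] Matrix Bo' Bo' ℂ}
    (hpost : ∀ M, (post M).trace = M.trace) :
    traceSnd (combOp pre post) =
      combMarginal pre ⊗ₖ ((1 / (Fintype.card Bo : ℂ)) • (1 : Matrix Bo Bo ℂ)) := by
  ext p q
  have h := hpost (Matrix.of fun u v => Matrix.single p.2 q.2 (1 : ℂ) u.1 v.1 *
      pre (Matrix.single p.1.2 q.1.2 1) (p.1.1, u.2) (q.1.1, v.2))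
  simp only [Matrix.trace, Matrix.diag_apply] at h
  simp only [traceSnd, combOp, Matrix.of_apply, ← Finset.mul_sum, h]
  simp only [combMarginal, Fintype.sum_prod_type, Matrix.kroneckerMap_apply, Matrix.of_apply,
    Matrix.smul_apply, smul_eq_mul, ← Finset.mul_sum, ← Finset.sum_mul]
  have h2 : ∑ k, Matrix.single p.2 q.2 (1 : ℂ) k k = (1 : Matrix Bo Bo ℂ) p.2 q.2 := by
    by_cases h : p.2 = q.2
    · rw [h, Matrix.one_apply_eq]
      simp [Matrix.single_apply]
    · rw [Matrix.one_apply_ne h]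
      refine Finset.sum_eq_zero fun k _ => ?_
      rw [Matrix.single_apply, if_neg]
      rintro ⟨h1, h2⟩
      exact h (h1.trans h2.symm)
  rw [h2]
  ring

lemma traceFst_combMarginal [Fintype S] [Fintype Bi]
    {pre : Matrix Bi' Bi' ℂ →ₗ[ℂ] Matrix (Bi × S) (Bi × S) ℂ}
    (hpre : ∀ M, (pre M).trace = M.trace) :
    traceFst (combMarginal pre) = (1 / (Fintype.card Bi' : ℂ)) • (1 : Matrix Bi' Bi' ℂ) := by
  ext i j
  have h := hpre (Matrix.single i j 1)
  rw [Matrix.trace, Fintype.sum_prod_type] at h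
  simp only [Matrix.diag_apply] at h
  simp only [traceFst, combMarginal, Matrix.of_apply, ← Finset.mul_sum, h, Matrix.smul_apply,
    smul_eq_mul]
  by_cases hij : i = j
  · subst hij
    simp
  · simp [hij]

lemma combOp_posSemidef [Fintype S] [Fintype Bi] [DecidableEq Bi] [Fintype Bo']
    {pre : Matrix Bi' Bi' ℂ →ₗ[ℂ] Matrix (Bi × S) (Bi × S) ℂ}
    {post : Matrix (Bo × S) (Bo × S) ℂ →ₗ[ℂ] Matrix Bo' Bo' ℂ}
    (hpre : IsCP pre) (hpost : IsCP post) : (combOp pre post).PosSemidef := by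
  classical
  have hC := hpre.posSemidef_ampl (Matrix.posSemidef_vecMulVec_self_star
    (fun p : Bi' × Bi' => if p.1 = p.2 then (1 : ℂ) else 0))
  let N := ampl Bi' pre (Matrix.vecMulVec (fun p : Bi' × Bi' => if p.1 = p.2 then (1 : ℂ) else 0)
    (star fun p : Bi' × Bi' => if p.1 = p.2 then (1 : ℂ) else 0))
  have hN : ∀ p q, N p q = pre (Matrix.single p.2 q.2 1) p.1 q.1 := by
    intro p q
    simp only [N, ampl_apply]
    refine congrFun (congrFun (congrArg pre ?_) _) _
    ext i j
    simp only [Matrix.vecMulVec_apply, Matrix.single_apply, Pi.star_apply, Matrix.of_apply,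
      eq_comm (a := i), eq_comm (a := j)]
    by_cases h1 : p.2 = i <;> by_cases h2 : q.2 = j <;> simp [h1, h2]
  -- The index map ignores both copies of B_out, which tensors N with an all-ones matrix; the
  -- diagonal indicator then cuts this down to N tensored with an unnormalised |Ω⟩⟨Ω| on B_out
  -- B_out.
  have h1 := (hC.submatrix (fun r : (Bo × S) × ((Bi × Bi') × Bo) =>
    ((r.2.1.1, r.1.2), r.2.1.2))).mul_mul_conjTranspose_same
      (Matrix.diagonal fun r : (Bo × S) × ((Bi × Bi') × Bo) => if r.2.2 = r.1.1 then (1 : ℂ) else 0)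
  have h2 := (hpost.posSemidef_ampl h1).submatrix
    (fun p : (((Bi × Bi') × Bo) × Bo') => (p.2, p.1))
  have h3 := h2.smul (α := ℝ) (a := 1 / ((Fintype.card Bo : ℝ) * (Fintype.card Bi' : ℝ)))
    (by positivity)
  refine (congrArg Matrix.PosSemidef ?_).mp h3
  ext p q
  simp only [Matrix.smul_apply, Matrix.submatrix_apply, ampl_apply, combOp, Matrix.of_apply]
  rw [Complex.real_smul]
  push_cast
  congr 2
  refine congrFun (congrFun (congrArg post ?_) _) _
  ext u v
  simp only [Matrix.of_apply]
  rw [Matrix.diagonal_conjTranspose, Matrix.mul_diagonal, Matrix.diagonal_mul]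
  simp only [Matrix.submatrix_apply]
  rw [show ampl Bi' pre (Matrix.vecMulVec _ _) ((p.1.1.1, u.2), p.1.1.2) ((q.1.1.1, v.2), q.1.1.2) =
    N _ _ from rfl, hN]
  by_cases h1 : p.1.2 = u.1 <;> by_cases h2 : q.1.2 = v.1 <;> simp [h1, h2]


end Combs

/-! ### The link product as insertion into a comb -/

section Link

variable {Bi Bo Bi' Bo' S : Type*} [Fintype Bi] [Fintype Bo] [Fintype Bi'] [Fintype Bo']
  [DecidableEq Bi'] [DecidableEq Bo']

/-- Moving T_in across the partial trace pairs K with the full transpose of J, so rows are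
contracted with rows and columns with columns. -/
lemma link_apply (J : Matrix (Bo × Bi) (Bo × Bi) ℂ) (K : CombOp Bi Bi' Bo Bo')
    (p q : Bo' × Bi') :
    link J K p q = ((Fintype.card Bi : ℂ) * (Fintype.card Bo : ℂ)) *
      ∑ s, ∑ k, ∑ s', ∑ k', J (k', s) (k, s') *
        K (((s, p.2), k'), p.1) (((s', q.2), k), q.1) := by
  rw [link, Matrix.smul_apply, smul_eq_mul]
  congr 1
  simp only [traceInner, Matrix.of_apply]
  refine Finset.sum_congr rfl fun s _ => Finset.sum_congr rfl fun k _ => ?_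
  rw [Matrix.mul_apply]
  simp only [Fintype.sum_prod_type, padInner, transposeBi, transposeFst, Matrix.of_apply]
  refine Finset.sum_congr rfl fun s' _ => ?_
  rw [Finset.sum_comm]
  refine Finset.sum_congr rfl fun k' _ => ?_
  rw [Finset.sum_eq_single p.2, Finset.sum_eq_single p.1]
  · simp
  · intro b _ hb
    rw [Matrix.one_apply_ne (by simp [Ne.symm hb])]
    simp
  · simp
  · intro a _ ha
    refine Finset.sum_eq_zero fun b _ => ?_
    rw [Matrix.one_apply_ne (by simp [Ne.symm ha])]
    simp
  · simp

/-- The link product, as a linear map of its second argument. -/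
def linkLinear (J : Matrix (Bo × Bi) (Bo × Bi) ℂ) :
    CombOp Bi Bi' Bo Bo' →ₗ[ℂ] Matrix (Bo' × Bi') (Bo' × Bi') ℂ where
  toFun K := link J K
  map_add' K L := by
    ext p q
    simp only [Matrix.add_apply, link_apply, mul_add, Finset.sum_add_distrib]
  map_smul' c K := by
    ext p q
    simp only [Matrix.smul_apply, link_apply, smul_eq_mul, RingHom.id_apply, Finset.mul_sum]
    refine Finset.sum_congr rfl fun s _ => Finset.sum_congr rfl fun k _ =>
      Finset.sum_congr rfl fun s' _ => Finset.sum_congr rfl fun k' _ => ?_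
    ring

lemma linkLinear_apply (J : Matrix (Bo × Bi) (Bo × Bi) ℂ) (K : CombOp Bi Bi' Bo Bo') :
    linkLinear J K = link J K := rfl

/-- The link product of the Choi operator of a map with the operator of a comb is the Choi
operator of the map obtained by inserting the map into the comb. -/
lemma link_choi_combOp [DecidableEq Bi] [DecidableEq Bo] [Nonempty Bi] [Nonempty Bo]
    (Φ : Matrix Bi Bi ℂ →ₗ[ℂ] Matrix Bo Bo ℂ)
    (pre : Matrix Bi' Bi' ℂ →ₗ[ℂ] Matrix (Bi × S) (Bi × S) ℂ)
    (post : Matrix (Bo × S) (Bo × S) ℂ →ₗ[ℂ] Matrix Bo' Bo' ℂ) :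
    link (choi Φ) (combOp pre post) = choi (post ∘ₗ ampl S Φ ∘ₗ pre) := by
  ext p q
  rw [link_apply, choi_apply]
  have h : ampl S Φ (pre (Matrix.single p.2 q.2 1)) = ∑ s, ∑ k, ∑ s', ∑ k',
      Φ (Matrix.single s s' 1) k' k • Matrix.of fun u v : Bo × S =>
        Matrix.single k' k (1 : ℂ) u.1 v.1 * pre (Matrix.single p.2 q.2 1) (s, u.2) (s', v.2) := by
    ext u v
    rw [ampl_apply, map_eq_sum_single Φ]
    simp only [Matrix.sum_apply, Matrix.smul_apply, Matrix.of_apply, smul_eq_mul]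
    refine Finset.sum_congr rfl fun s _ => ?_
    rw [Finset.sum_comm]
    refine Finset.sum_congr rfl fun s' _ => ?_
    rw [Finset.sum_eq_single v.1, Finset.sum_eq_single u.1]
    · simp [mul_comm]
    · intro k _ hk
      simp [hk]
    · simp
    · intro k _ hk
      refine Finset.sum_eq_zero fun k' _ => ?_
      simp [hk]
    · simp
  -- The prefactor of the link product cancels 1/d_{B_in} from `choi Φ` and 1/d_{B_out} from
  -- `combOp`; the remaining 1/d_{B'_in'} normalises the composite.
  have hBi : (Fintype.card Bi : ℂ) ≠ 0 := Nat.cast_ne_zero.2 Fintype.card_ne_zero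
  have hBo : (Fintype.card Bo : ℂ) ≠ 0 := Nat.cast_ne_zero.2 Fintype.card_ne_zero
  rw [LinearMap.comp_apply, LinearMap.comp_apply, h]
  simp only [map_sum, map_smul, Matrix.sum_apply, Matrix.smul_apply, smul_eq_mul, Finset.mul_sum]
  refine Finset.sum_congr rfl fun s _ => Finset.sum_congr rfl fun k _ =>
      Finset.sum_congr rfl fun s' _ => Finset.sum_congr rfl fun k' _ => ?_
  rw [choi_apply]
  simp only [combOp, Matrix.of_apply]
  field_simp

end Link

/-! ### Generalised inverses and supports of marginals -/

section Realization

/-- A square root of a positive semidefinite matrix together with a generalised inverse. -/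
lemma exists_sqrt_pinv {n : Type*} [Fintype n] [DecidableEq n] {C : Matrix n n ℂ}
    (hC : C.PosSemidef) :
    ∃ (R : Matrix n (Fin (Fintype.card n)) ℂ) (G : Matrix (Fin (Fintype.card n)) n ℂ),
      R * Rᴴ = C ∧ (G * R)ᴴ = G * R ∧ R * G * R = R := by
  suffices h : ∃ (R G : Matrix n n ℂ), R * Rᴴ = C ∧ (G * R)ᴴ = G * R ∧ R * G * R = R by
    obtain ⟨R, G, h1, h2, h3⟩ := h
    let e := (Fintype.equivFin n).symm
    refine ⟨R.submatrix id e, G.submatrix e id, ?_, ?_, ?_⟩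
    · rw [Matrix.conjTranspose_submatrix, Matrix.submatrix_mul_equiv, h1, Matrix.submatrix_id_id]
    · rw [← Matrix.submatrix_mul _ _ _ _ _ Function.bijective_id, Matrix.conjTranspose_submatrix,
        h2]
    · rw [Matrix.submatrix_mul_equiv, ← Matrix.submatrix_mul _ _ _ _ _ Function.bijective_id, h3]
  set U : Matrix n n ℂ := hC.1.eigenvectorUnitary.1
  have hU : star U * U = 1 := Unitary.coe_star_mul_self hC.1.eigenvectorUnitary
  set ev := hC.1.eigenvalues
  have hev : ∀ i, 0 ≤ ev i := hC.eigenvalues_nonneg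
  have hspec : C = U * Matrix.diagonal (fun i => (ev i : ℂ)) * star U := by
    have := hC.1.spectral_theorem
    rwa [Unitary.conjStarAlgAut_apply] at this
  have hGR : Matrix.diagonal (fun i => (((Real.sqrt (ev i))⁻¹ : ℝ) : ℂ)) * star U *
      (U * Matrix.diagonal (fun i => ((Real.sqrt (ev i) : ℝ) : ℂ))) =
      Matrix.diagonal (fun i => (((Real.sqrt (ev i))⁻¹ * Real.sqrt (ev i) : ℝ) : ℂ)) := by
    rw [Matrix.mul_assoc, ← Matrix.mul_assoc (star U), hU, Matrix.one_mul,
      Matrix.diagonal_mul_diagonal]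
    congr 1
    ext i
    push_cast
    rfl
  -- Since `0⁻¹ = 0`, G inverts R only on nonzero eigenvalues, and G R is the projection onto them.
  refine ⟨U * Matrix.diagonal (fun i => ((Real.sqrt (ev i) : ℝ) : ℂ)),
    Matrix.diagonal (fun i => (((Real.sqrt (ev i))⁻¹ : ℝ) : ℂ)) * star U, ?_, ?_, ?_⟩
  · rw [Matrix.conjTranspose_mul, Matrix.diagonal_conjTranspose, hspec, Matrix.mul_assoc,
      ← Matrix.mul_assoc (Matrix.diagonal _), Matrix.diagonal_mul_diagonal, Matrix.mul_assoc]
    congr 3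
    ext i
    simp only [Pi.star_apply]
    rw [Complex.star_def, Complex.conj_ofReal, ← Complex.ofReal_mul, Real.mul_self_sqrt (hev i)]
  · rw [hGR, Matrix.diagonal_conjTranspose]
    congr 1
    ext i
    simp only [Pi.star_apply]
    rw [Complex.star_def, Complex.conj_ofReal]
  · rw [Matrix.mul_assoc (U * _), hGR, Matrix.mul_assoc, Matrix.diagonal_mul_diagonal]
    congr 2
    ext i
    rw [← Complex.ofReal_mul]
    congr 1
    by_cases h : Real.sqrt (ev i) = 0
    · simp [h]
    · field_simp

variable {n m l : Type*}

lemma traceSnd_add [Fintype m] (M N : Matrix (n × m) (n × m) ℂ) :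
    traceSnd (M + N) = traceSnd M + traceSnd N := by
  ext i j
  simp [traceSnd, Finset.sum_add_distrib]

lemma traceSnd_smul [Fintype m] (c : ℂ) (M : Matrix (n × m) (n × m) ℂ) :
    traceSnd (c • M) = c • traceSnd M := by
  ext i j
  simp [traceSnd, Finset.mul_sum]

lemma traceSnd_kronecker [Fintype m] (M : Matrix n n ℂ) (N : Matrix m m ℂ) :
    traceSnd (M ⊗ₖ N) = N.trace • M := by
  ext i j
  simp [traceSnd, Matrix.trace, ← Finset.mul_sum, mul_comm]

lemma trace_traceSnd [Fintype n] [Fintype m] (M : Matrix (n × m) (n × m) ℂ) :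
    (traceSnd M).trace = M.trace := by
  simp [traceSnd, Matrix.trace, Fintype.sum_prod_type]

lemma kronecker_one_mul_mul_apply [Fintype n] [Fintype m] [DecidableEq m] (V : Matrix l n ℂ)
    (M : Matrix (n × m) (n × m) ℂ) (p q : l × m) :
    ((V ⊗ₖ (1 : Matrix m m ℂ)) * M * (V ⊗ₖ (1 : Matrix m m ℂ))ᴴ) p q =
      ∑ i, ∑ j, V p.1 i * M (i, p.2) (j, q.2) * star (V q.1 j) := by
  rw [Matrix.mul_apply, Fintype.sum_prod_type_right]
  rw [Finset.sum_eq_single q.2]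
  · rw [Finset.sum_comm]
    refine Finset.sum_congr rfl fun j _ => ?_
    rw [Matrix.mul_apply, Fintype.sum_prod_type, Finset.sum_mul]
    refine Finset.sum_congr rfl fun i _ => ?_
    rw [Finset.sum_eq_single p.2]
    · simp [Matrix.kroneckerMap_apply, Matrix.conjTranspose_apply]
    · intro b _ hb
      simp [Ne.symm hb]
    · simp
  · intro b _ hb
    refine Finset.sum_eq_zero fun j _ => ?_
    simp [Ne.symm hb]
  · simp

lemma traceSnd_kronecker_one_mul_mul [Fintype n] [Fintype m] [DecidableEq m] (V : Matrix l n ℂ)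
    (M : Matrix (n × m) (n × m) ℂ) :
    traceSnd ((V ⊗ₖ (1 : Matrix m m ℂ)) * M * (V ⊗ₖ (1 : Matrix m m ℂ))ᴴ) =
      V * traceSnd M * Vᴴ := by
  ext p q
  simp only [traceSnd, Matrix.of_apply, kronecker_one_mul_mul_apply]
  simp only [Matrix.mul_apply, Matrix.of_apply, Finset.sum_mul, Finset.mul_sum,
    Matrix.conjTranspose_apply]
  rw [Finset.sum_comm]
  conv_rhs => rw [Finset.sum_comm]
  exact Finset.sum_congr rfl fun i _ => Finset.sum_comm

/-- If `V` annihilates the marginal of a positive semidefinite matrix, then `V ⊗ 1` annihilates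
the matrix. -/
lemma kronecker_one_mul_eq_zero [Fintype n] [Fintype m] [Fintype l] [DecidableEq n]
    [DecidableEq m] {V : Matrix l n ℂ} {M : Matrix (n × m) (n × m) ℂ} (hM : M.PosSemidef)
    (h : V * traceSnd M * Vᴴ = 0) : (V ⊗ₖ (1 : Matrix m m ℂ)) * M = 0 := by
  -- A positive semidefinite matrix of trace zero vanishes, and this trace is that of V (tr M) V†.
  have h1 : ((V ⊗ₖ (1 : Matrix m m ℂ)) * M * (V ⊗ₖ (1 : Matrix m m ℂ))ᴴ) = 0 := by
    rw [← (hM.mul_mul_conjTranspose_same _).trace_eq_zero_iff, ← trace_traceSnd,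
      traceSnd_kronecker_one_mul_mul, h, Matrix.trace_zero]
  obtain ⟨R, -, hR, -, -⟩ := exists_sqrt_pinv hM
  rw [← hR] at h1 ⊢
  have h2 : ((V ⊗ₖ (1 : Matrix m m ℂ)) * R) * ((V ⊗ₖ (1 : Matrix m m ℂ)) * R)ᴴ = 0 := by
    rw [Matrix.conjTranspose_mul, ← h1]
    simp only [Matrix.mul_assoc]
  rw [← Matrix.mul_assoc, Matrix.self_mul_conjTranspose_eq_zero.1 h2, Matrix.zero_mul]

end Realization

/-! ### Realising operators with comb marginals by two channels -/

section CombRealization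

variable {Bi Bo Bi' Bo' : Type*} [Fintype Bi] [DecidableEq Bi] [Fintype Bo] [DecidableEq Bo]
  [Fintype Bi'] [DecidableEq Bi'] [Fintype Bo'] [DecidableEq Bo']

/-- A positive semidefinite operator with the marginals of a comb consists of two channels which
are connected by a memory. -/
lemma exists_combOp_eq_of_traceSnd [Nonempty Bo] [Nonempty Bi'] [Nonempty Bo']
    {C : Matrix (Bi × Bi') (Bi × Bi') ℂ} {K : CombOp Bi Bi' Bo Bo'} (hC : C.PosSemidef)
    (hC1 : traceFst C = 1) (hK : K.PosSemidef)
    (hK1 : traceSnd K = C ⊗ₖ (1 : Matrix Bo Bo ℂ)) :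
    ∃ (pre : Matrix Bi' Bi' ℂ →ₗ[ℂ] Matrix (Bi × Fin (Fintype.card (Bi × Bi')))
        (Bi × Fin (Fintype.card (Bi × Bi'))) ℂ)
      (post : Matrix (Bo × Fin (Fintype.card (Bi × Bi')))
        (Bo × Fin (Fintype.card (Bi × Bi'))) ℂ →ₗ[ℂ] Matrix Bo' Bo' ℂ),
      IsCPTP pre ∧ IsCPTP post ∧
        K = ((Fintype.card Bo : ℂ) * (Fintype.card Bi' : ℂ)) • combOp pre post := by
  obtain ⟨b₀⟩ := ‹Nonempty Bo'›
  obtain ⟨R, G, hR, hGR, hRGR⟩ := exists_sqrt_pinv hC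
  have hP : (1 - G * R) * (1 - G * R)ᴴ = 1 - G * R := by
    have h : G * R * (G * R) = G * R := by
      rw [Matrix.mul_assoc, ← Matrix.mul_assoc R, hRGR]
    rw [Matrix.conjTranspose_sub, hGR, Matrix.conjTranspose_one, Matrix.mul_sub, Matrix.mul_one,
      Matrix.sub_mul, h, Matrix.one_mul, sub_self, sub_zero]
  have hGC : G * C * Gᴴ = G * R := by
    rw [← hR, ← Matrix.mul_assoc, Matrix.mul_assoc, ← Matrix.conjTranspose_mul, hGR,
      Matrix.mul_assoc, ← Matrix.mul_assoc R, hRGR]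
  -- the kernel of the post-processing map, up to the order of the tensor factors
  let Q : Matrix ((Fin (Fintype.card (Bi × Bi')) × Bo) × Bo')
      ((Fin (Fintype.card (Bi × Bi')) × Bo) × Bo') ℂ :=
    ((G ⊗ₖ (1 : Matrix Bo Bo ℂ)) ⊗ₖ (1 : Matrix Bo' Bo' ℂ)) * K *
      ((G ⊗ₖ (1 : Matrix Bo Bo ℂ)) ⊗ₖ (1 : Matrix Bo' Bo' ℂ))ᴴ +
    ((1 - G * R) ⊗ₖ (1 : Matrix Bo Bo ℂ)) ⊗ₖ
      Matrix.diagonal (fun b : Bo' => if b = b₀ then (1 : ℂ) else 0)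
  have hQ : Q.PosSemidef := by
    refine (hK.mul_mul_conjTranspose_same _).add (.kronecker (.kronecker ?_ .one) (.diagonal ?_))
    · rw [← hP]
      exact Matrix.posSemidef_self_mul_conjTranspose _
    · intro b
      dsimp only [Pi.zero_apply]
      split_ifs
      · exact zero_le_one
      · exact le_rfl
  -- The first summand contributes the projection G R; the second, which prepares b₀ off the
  -- support, contributes 1 - G R.
  have hQ1 : traceSnd Q = 1 := by
    simp only [Q]
    rw [traceSnd_add, traceSnd_kronecker_one_mul_mul, traceSnd_kronecker, hK1,
      Matrix.conjTranspose_kronecker, ← Matrix.mul_kronecker_mul, ← Matrix.mul_kronecker_mul, hGC]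
    simp [Matrix.trace, ← Matrix.add_kronecker]
  -- Conjugation by R undoes that by G: 1 - R G annihilates the marginal of K, hence K itself, and R
  -- (1 - G R) = 0 removes the correction term.
  have hQK : ((R ⊗ₖ (1 : Matrix Bo Bo ℂ)) ⊗ₖ (1 : Matrix Bo' Bo' ℂ)) * Q *
      ((R ⊗ₖ (1 : Matrix Bo Bo ℂ)) ⊗ₖ (1 : Matrix Bo' Bo' ℂ))ᴴ = K := by
    have h0 : (((1 - R * G) ⊗ₖ (1 : Matrix Bo Bo ℂ)) ⊗ₖ (1 : Matrix Bo' Bo' ℂ)) * K = 0 := by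
      refine kronecker_one_mul_eq_zero hK ?_
      rw [hK1, ← Matrix.mul_kronecker_mul, ← hR, ← Matrix.mul_assoc, Matrix.sub_mul, hRGR]
      simp
    have h1 : (((R * G) ⊗ₖ (1 : Matrix Bo Bo ℂ)) ⊗ₖ (1 : Matrix Bo' Bo' ℂ)) * K = K := by
      have h : (((1 - R * G) ⊗ₖ (1 : Matrix Bo Bo ℂ)) ⊗ₖ (1 : Matrix Bo' Bo' ℂ)) =
          1 - (((R * G) ⊗ₖ (1 : Matrix Bo Bo ℂ)) ⊗ₖ (1 : Matrix Bo' Bo' ℂ)) := by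
        rw [eq_sub_iff_add_eq, ← Matrix.add_kronecker, ← Matrix.add_kronecker, sub_add_cancel,
          Matrix.one_kronecker_one, Matrix.one_kronecker_one]
      rw [h, Matrix.sub_mul, Matrix.one_mul, sub_eq_zero] at h0
      exact h0.symm
    have h2 : K * (((R * G) ⊗ₖ (1 : Matrix Bo Bo ℂ)) ⊗ₖ (1 : Matrix Bo' Bo' ℂ))ᴴ = K := by
      have h := congrArg Matrix.conjTranspose h1
      rwa [Matrix.conjTranspose_mul, hK.1.eq] at h
    have h3 : ((R ⊗ₖ (1 : Matrix Bo Bo ℂ)) ⊗ₖ (1 : Matrix Bo' Bo' ℂ)) *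
        ((G ⊗ₖ (1 : Matrix Bo Bo ℂ)) ⊗ₖ (1 : Matrix Bo' Bo' ℂ)) =
        ((R * G) ⊗ₖ (1 : Matrix Bo Bo ℂ)) ⊗ₖ (1 : Matrix Bo' Bo' ℂ) := by
      simp only [← Matrix.mul_kronecker_mul, Matrix.mul_one]
    have h4 : ((R ⊗ₖ (1 : Matrix Bo Bo ℂ)) ⊗ₖ (1 : Matrix Bo' Bo' ℂ)) *
        (((1 - G * R) ⊗ₖ (1 : Matrix Bo Bo ℂ)) ⊗ₖ
          Matrix.diagonal (fun b : Bo' => if b = b₀ then (1 : ℂ) else 0)) = 0 := by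
      rw [← Matrix.mul_kronecker_mul, ← Matrix.mul_kronecker_mul, Matrix.mul_sub,
        ← Matrix.mul_assoc, hRGR]
      simp
    simp only [Q]
    rw [Matrix.mul_add, h4, add_zero, ← Matrix.mul_assoc, ← Matrix.mul_assoc, h3, h1,
      Matrix.mul_assoc, ← Matrix.conjTranspose_mul, h3, h2]
  -- The vector of the map |a⟩ ↦ ∑ R((s,a),t) |s,t⟩, with the column index of R as memory. It is an
  -- isometry because C traces to the identity over B_in.
  let v : Bi' × (Bi × Fin (Fintype.card (Bi × Bi'))) → ℂ := fun p => R (p.2.1, p.1) p.2.2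
  have hpre1 : traceSnd (Matrix.vecMulVec v (star v)) = 1 := by
    rw [← hC1, ← hR]
    ext i j
    simp [traceSnd, traceFst, Matrix.vecMulVec_apply, v, Fintype.sum_prod_type, Matrix.mul_apply]
  let f : (Bo × Fin (Fintype.card (Bi × Bi'))) × Bo' →
      (Fin (Fintype.card (Bi × Bi')) × Bo) × Bo' := fun p => ((p.1.2, p.1.1), p.2)
  have hpost1 : traceSnd (Q.submatrix f f) = 1 := by
    ext i j
    have h := congrFun (congrFun hQ1 (i.2, i.1)) (j.2, j.1)
    rw [← Matrix.one_kronecker_one, Matrix.kroneckerMap_apply] at h ⊢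
    rw [mul_comm]
    exact h
  refine ⟨kernelMap (Matrix.vecMulVec v (star v)), kernelMap (Q.submatrix f f),
    isCPTP_kernelMap (Matrix.posSemidef_vecMulVec_self_star v) hpre1,
    isCPTP_kernelMap (hQ.submatrix f) hpost1, ?_⟩
  have hBo : (Fintype.card Bo : ℂ) ≠ 0 := Nat.cast_ne_zero.2 Fintype.card_ne_zero
  have hBi' : (Fintype.card Bi' : ℂ) ≠ 0 := Nat.cast_ne_zero.2 Fintype.card_ne_zero
  have hpre : ∀ a a' p q, kernelMap (Matrix.vecMulVec v (star v)) (Matrix.single a a' 1) p q =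
      R (p.1, a) p.2 * star (R (q.1, a') q.2) := by
    intro a a' p q
    rw [kernelMap_apply, Finset.sum_eq_single a, Finset.sum_eq_single a']
    · simp [Matrix.vecMulVec_apply, v]
    · intro j _ hj
      simp [Ne.symm hj]
    · simp
    · intro i _ hi
      simp [Ne.symm hi]
    · simp
  ext p q
  -- With these two channels, the entries of the unnormalised comb are exactly those of R Q R†.
  rw [← congrFun (congrFun hQK p) q, kronecker_one_mul_mul_apply]
  simp only [Matrix.smul_apply, smul_eq_mul, combOp, Matrix.of_apply, kernelMap_apply (n := Bo × _),
    hpre, Matrix.submatrix_apply, f]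
  rw [← mul_assoc, mul_one_div_cancel (mul_ne_zero hBo hBi'), one_mul]
  have hs : ∀ (k₀ : Bo) (φ : Bo → ℂ), (∀ k, k ≠ k₀ → φ k = 0) → ∑ k, φ k = φ k₀ :=
    fun k₀ φ h => Finset.sum_eq_single k₀ (fun k _ hk => h k hk) (by simp)
  trans ∑ s, ∑ t, R p.1.1 s * Q ((s, p.1.2), p.2) ((t, q.1.2), q.2) * star (R q.1.1 t)
  · rw [Fintype.sum_prod_type]
    refine Finset.sum_congr rfl fun s _ => ?_
    rw [hs p.1.2 _ fun k hk => by simp [Ne.symm hk], Fintype.sum_prod_type]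
    refine Finset.sum_congr rfl fun t _ => ?_
    rw [hs q.1.2 _ fun k hk => by simp [Ne.symm hk]]
    simp
  · rw [Fintype.sum_prod_type_right]
    refine Finset.sum_congr rfl fun s _ => ?_
    rw [hs p.1.2 _ fun k hk => by simp [Ne.symm hk], Fintype.sum_prod_type_right]
    refine Finset.sum_congr rfl fun t _ => ?_
    rw [hs q.1.2 _ fun k hk => by simp [Ne.symm hk]]
    simp only [Matrix.single_apply_same]
    ring

/-- A positive semidefinite operator with the marginals of a subnormalised comb is a multiple of
the operator of two channels which are connected by a memory. -/
lemma exists_smul_combOp [Nonempty Bi] [Nonempty Bo] [Nonempty Bi'] [Nonempty Bo']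
    {F : Matrix (Bi × Bi') (Bi × Bi') ℂ} {K : CombOp Bi Bi' Bo Bo'} {c : ℂ} (hF : F.PosSemidef)
    (hF1 : traceFst F = c • 1) (hK : K.PosSemidef)
    (hK1 : traceSnd K = F ⊗ₖ ((1 / (Fintype.card Bo : ℂ)) • (1 : Matrix Bo Bo ℂ))) :
    ∃ (t : ℝ) (pre : Matrix Bi' Bi' ℂ →ₗ[ℂ] Matrix (Bi × Fin (Fintype.card (Bi × Bi')))
        (Bi × Fin (Fintype.card (Bi × Bi'))) ℂ)
      (post : Matrix (Bo × Fin (Fintype.card (Bi × Bi')))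
        (Bo × Fin (Fintype.card (Bi × Bi'))) ℂ →ₗ[ℂ] Matrix Bo' Bo' ℂ),
      0 ≤ t ∧ IsCPTP pre ∧ IsCPTP post ∧ K = (t : ℂ) • combOp pre post := by
  have hBo : (Fintype.card Bo : ℂ) ≠ 0 := Nat.cast_ne_zero.2 Fintype.card_ne_zero
  have hBi' : (Fintype.card Bi' : ℂ) ≠ 0 := Nat.cast_ne_zero.2 Fintype.card_ne_zero
  have htr : F.trace = c * Fintype.card Bi' := by
    have h := congrArg Matrix.trace hF1
    rw [Matrix.trace_smul, Matrix.trace_one, smul_eq_mul] at h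
    rw [← h]
    simp only [Matrix.trace, Matrix.diag_apply, traceFst, Matrix.of_apply]
    rw [Fintype.sum_prod_type_right]
  have hc : 0 ≤ c := by
    have h := mul_nonneg hF.trace_nonneg (inv_nonneg.2 (Nat.cast_nonneg (Fintype.card Bi')))
    rwa [htr, mul_inv_cancel_right₀ hBi'] at h
  obtain ⟨r, hr, rfl⟩ : ∃ r : ℝ, 0 ≤ r ∧ (r : ℂ) = c := by
    rw [Complex.le_def] at hc
    exact ⟨c.re, by simpa using hc.1, Complex.ext (by simp) (by simpa using hc.2)⟩
  -- For r = 0 both F and K have trace zero and so vanish; any pair of channels will do.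
  rcases hr.eq_or_lt with rfl | hr
  · have : Nonempty (Fin (Fintype.card (Bi × Bi'))) := ⟨⟨0, Fintype.card_pos⟩⟩
    obtain ⟨pre, hpre⟩ := exists_isCPTP (n := Bi') (m := Bi × Fin (Fintype.card (Bi × Bi')))
    obtain ⟨post, hpost⟩ := exists_isCPTP (n := Bo × Fin (Fintype.card (Bi × Bi'))) (m := Bo')
    refine ⟨0, pre, post, le_rfl, hpre, hpost, ?_⟩
    have hF0 : F = 0 := by rw [← hF.trace_eq_zero_iff, htr]; simp
    rw [Complex.ofReal_zero, zero_smul, ← hK.trace_eq_zero_iff, ← trace_traceSnd, hK1, hF0]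
    simp
  · have hr' : (r : ℂ) ≠ 0 := Complex.ofReal_ne_zero.2 hr.ne'
    have hC1 : traceFst (((r⁻¹ : ℝ) : ℂ) • F) = 1 := by
      ext i j
      have h := congrFun (congrFun hF1 i) j
      simp only [traceFst, Matrix.of_apply, Matrix.smul_apply, smul_eq_mul] at h
      simp only [traceFst, Matrix.of_apply, Matrix.smul_apply, smul_eq_mul, ← Finset.mul_sum, h]
      push_cast
      field_simp
    have hK2 : traceSnd (((r⁻¹ * Fintype.card Bo : ℝ) : ℂ) • K) =
        (((r⁻¹ : ℝ) : ℂ) • F) ⊗ₖ (1 : Matrix Bo Bo ℂ) := by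
      rw [traceSnd_smul, hK1, Matrix.kronecker_smul, smul_smul, Matrix.smul_kronecker]
      congr 1
      push_cast
      field_simp
    obtain ⟨pre, post, hpre, hpost, h⟩ := exists_combOp_eq_of_traceSnd
      (hF.smul (Complex.zero_le_real.2 (inv_nonneg.2 hr.le))) hC1
      (hK.smul (Complex.zero_le_real.2 (mul_nonneg (inv_nonneg.2 hr.le) (Nat.cast_nonneg _)))) hK2
    -- The rescaled operator d_{B_out} r⁻¹ K equals d_{B_out} d_{B'_in'} times a `combOp`; solving
    -- for K gives this factor.
    refine ⟨r * Fintype.card Bi', pre, post, by positivity, hpre, hpost, ?_⟩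
    have h2 := congrArg (fun M => ((r : ℂ) * (Fintype.card Bo : ℂ)⁻¹) • M) h
    simp only [smul_smul] at h2
    convert h2 using 2
    · rw [show (r : ℂ) * (Fintype.card Bo : ℂ)⁻¹ * ((r⁻¹ * Fintype.card Bo : ℝ) : ℂ) = 1 by
        push_cast; field_simp, one_smul]
    · push_cast
      field_simp

end CombRealization

/-! ### Countable sums of positive semidefinite matrices -/

section Series

variable {ι n m k l : Type*}

lemma hasSum_matrix_iff {f : ι → Matrix m n ℂ} {a : Matrix m n ℂ} :
    HasSum f a ↔ ∀ i j, HasSum (fun t => f t i j) (a i j) :=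
  Pi.hasSum.trans (forall_congr' fun _ => Pi.hasSum)

lemma hasSum_map_matrix [Fintype m] [Fintype n] (L : Matrix m n ℂ →ₗ[ℂ] Matrix k l ℂ)
    {f : ι → Matrix m n ℂ} {a : Matrix m n ℂ} (h : HasSum f a) :
    HasSum (fun t => L (f t)) (L a) :=
  h.map L L.continuous_of_finiteDimensional

/-- Sums of positive semidefinite matrices are positive semidefinite. -/
lemma posSemidef_of_hasSum [Fintype n] {f : ι → Matrix n n ℂ} {a : Matrix n n ℂ}
    (h : HasSum f a) (hf : ∀ t, (f t).PosSemidef) : a.PosSemidef := by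
  refine .of_dotProduct_mulVec_nonneg ?_ fun x => ?_
  · have h2 := h.matrix_conjTranspose
    simp_rw [fun t => (hf t).1.eq] at h2
    exact h2.unique h
  · have h2 : HasSum (fun t => star x ⬝ᵥ (f t *ᵥ x)) (star x ⬝ᵥ (a *ᵥ x)) := by
      simp only [dotProduct, Matrix.mulVec]
      exact hasSum_sum fun i _ => (hasSum_sum fun j _ =>
        (hasSum_matrix_iff.1 h i j).mul_right (x j)).mul_left _
    exact h2.nonneg fun t => (hf t).dotProduct_mulVec_nonneg x

/-- The entries of a positive semidefinite matrix are bounded by its trace. -/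
lemma norm_apply_le_trace [Fintype n] {M : Matrix n n ℂ} (hM : M.PosSemidef) (i j : n) :
    ‖M i j‖ ≤ M.trace.re := by
  classical
  obtain ⟨R, -, hR, -, -⟩ := exists_sqrt_pinv hM
  have hdiag : ∀ i, (M i i).re = ∑ k, ‖R i k‖ ^ 2 := fun i => by
    rw [← hR, Matrix.mul_apply, Complex.re_sum]
    refine Finset.sum_congr rfl fun k _ => ?_
    rw [Matrix.conjTranspose_apply, Complex.star_def, Complex.mul_conj, Complex.ofReal_re,
      Complex.normSq_eq_norm_sq]
  have htr : ∀ i, (M i i).re ≤ M.trace.re := fun i => by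
    rw [Matrix.trace, Complex.re_sum]
    refine Finset.single_le_sum (f := fun i => (M i i).re) (fun i _ => ?_) (Finset.mem_univ i)
    rw [hdiag]
    positivity
  calc ‖M i j‖ ≤ ∑ k, ‖R i k‖ * ‖R j k‖ := by
        rw [← hR, Matrix.mul_apply]
        refine (norm_sum_le _ _).trans (Finset.sum_le_sum fun k _ => ?_)
        rw [norm_mul, Matrix.conjTranspose_apply, norm_star]
    _ ≤ ∑ k, (‖R i k‖ ^ 2 + ‖R j k‖ ^ 2) / 2 := by
        refine Finset.sum_le_sum fun k _ => ?_
        linarith [two_mul_le_add_sq ‖R i k‖ ‖R j k‖]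
    _ = ((M i i).re + (M j j).re) / 2 := by
        rw [hdiag, hdiag, ← Finset.sum_add_distrib, Finset.sum_div]
    _ ≤ M.trace.re := by linarith [htr i, htr j]

/-- Convergence of countable mixtures of positive semidefinite matrices of unit trace. -/
lemma summable_smul_of_posSemidef [Fintype n] {M : ι → Matrix n n ℂ} {c : ι → ℝ}
    (hM : ∀ t, (M t).PosSemidef) (hM1 : ∀ t, (M t).trace = 1) (hc : Summable c)
    (hc0 : ∀ t, 0 ≤ c t) : Summable fun t => (c t : ℂ) • M t := by
  have h : ∀ i j, Summable fun t => (c t : ℂ) * M t i j := fun i j =>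
    Summable.of_norm_bounded hc fun t => by
      rw [norm_mul, Complex.norm_real, Real.norm_of_nonneg (hc0 t)]
      refine mul_le_of_le_one_right (hc0 t) ((norm_apply_le_trace (hM t) i j).trans ?_)
      rw [hM1, Complex.one_re]
  exact ⟨Matrix.of fun i j => ∑' t, (c t : ℂ) * M t i j,
    hasSum_matrix_iff.2 fun i j => (h i j).hasSum⟩

lemma posSemidef_traceSnd [Fintype n] [Fintype m] {M : Matrix (n × m) (n × m) ℂ}
    (hM : M.PosSemidef) : (traceSnd M).PosSemidef := by
  have h : traceSnd M = ∑ k, M.submatrix (fun i => (i, k)) (fun i => (i, k)) := by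
    ext i j
    simp [traceSnd, Matrix.sum_apply]
  rw [h]
  exact Matrix.posSemidef_sum _ fun k _ => hM.submatrix _

/-- The partial trace over the second factor, as a linear map. -/
def traceSndLinear (n m : Type*) [Fintype m] : Matrix (n × m) (n × m) ℂ →ₗ[ℂ] Matrix n n ℂ where
  toFun := traceSnd
  map_add' := traceSnd_add
  map_smul' := traceSnd_smul

lemma traceSndLinear_apply [Fintype m] (M : Matrix (n × m) (n × m) ℂ) :
    traceSndLinear n m M = traceSnd M := rfl

/-- The partial trace over the first factor, as a linear map. -/
def traceFstLinear (n m : Type*) [Fintype n] : Matrix (n × m) (n × m) ℂ →ₗ[ℂ] Matrix m m ℂ where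
  toFun := traceFst
  map_add' M N := by
    ext i j
    simp [traceFst, Finset.sum_add_distrib]
  map_smul' c M := by
    ext i j
    simp [traceFst, Finset.mul_sum]

lemma traceFstLinear_apply [Fintype n] (M : Matrix (n × m) (n × m) ℂ) :
    traceFstLinear n m M = traceFst M := rfl

lemma trace_traceFst [Fintype n] [Fintype m] (M : Matrix (n × m) (n × m) ℂ) :
    (traceFst M).trace = M.trace := by
  simp [traceFst, Matrix.trace, Fintype.sum_prod_type_right]

end Series

/-! ### From an LOSR operation to a solution of the program -/

section Conversion

variable {A X A' X' Bi Bo Bi' Bo' : Type*}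
    [Fintype A] [DecidableEq A] [Nonempty A] [Fintype X] [DecidableEq X]
    [Fintype A'] [DecidableEq A'] [Nonempty A'] [Fintype X'] [DecidableEq X']
    [Fintype Bi] [DecidableEq Bi] [Nonempty Bi] [Fintype Bo] [DecidableEq Bo] [Nonempty Bo]
    [Fintype Bi'] [DecidableEq Bi'] [Nonempty Bi'] [Fintype Bo'] [DecidableEq Bo']
    {I : A → X → Matrix Bi Bi ℂ →ₗ[ℂ] Matrix Bo Bo ℂ}
    {I' : A' → X' → Matrix Bi' Bi' ℂ →ₗ[ℂ] Matrix Bo' Bo' ℂ}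

/-- Strategy s receives the average of the comb operators weighted by p(t) w_t(s); the
proportionality constants come from its total weight c s. -/
lemma LOSRConvertible.sdpFeasible (h : LOSRConvertible I I') :
    SDPFeasible (fun a x => choi (I a x)) (fun a' x' => choi (I' a' x')) := by
  obtain ⟨T, hT⟩ := h
  have hBo : (Fintype.card Bo : ℂ) ≠ 0 := Nat.cast_ne_zero.2 Fintype.card_ne_zero
  have hBi' : (Fintype.card Bi' : ℂ) ≠ 0 := Nat.cast_ne_zero.2 Fintype.card_ne_zero
  choose w hw0 hw1 hw using fun t => exists_strategy_weights (T.alice t) (T.alice_nonneg t)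
    (T.alice_sum t) (T.alice_noRetro t)
  set K : T.Lam → CombOp Bi Bi' Bo Bo' := fun t => combOp (T.pre t) (T.post t) with hKdef
  have hK : ∀ t, (K t).PosSemidef := fun t =>
    combOp_posSemidef (T.pre_cptp t).1 (T.post_cptp t).1
  have hone : ((1 / (Fintype.card Bo : ℂ)) • (1 : Matrix Bo Bo ℂ)).trace = 1 := by
    rw [Matrix.trace_smul, Matrix.trace_one, smul_eq_mul, one_div_mul_cancel hBo]
  -- Since 𝟙/d has trace one, F is recovered as a double partial trace of the comb operator. It thus
  -- depends linearly on that operator, and the same formula yields JF.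
  have hKsnd : ∀ t, traceSnd (traceSnd (K t)) = combMarginal (T.pre t) := fun t => by
    rw [hKdef]
    dsimp only
    rw [traceSnd_combOp _ (T.post_cptp t).2, traceSnd_kronecker, hone, one_smul]
  have hKsig : ∀ t, traceSnd (K t) =
      traceSnd (traceSnd (K t)) ⊗ₖ ((1 / (Fintype.card Bo : ℂ)) • (1 : Matrix Bo Bo ℂ)) :=
    fun t => by rw [hKsnd, ← traceSnd_combOp _ (T.post_cptp t).2]
  have hKfst : ∀ t, traceFst (traceSnd (traceSnd (K t))) =
      (1 / (Fintype.card Bi' : ℂ)) • (1 : Matrix Bi' Bi' ℂ) := fun t => by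
    rw [hKsnd, traceFst_combMarginal (T.pre_cptp t).2]
  have hKtr : ∀ t, (K t).trace = 1 := fun t => by
    rw [← trace_traceSnd, ← trace_traceSnd, ← trace_traceFst, hKfst, Matrix.trace_smul,
      Matrix.trace_one, smul_eq_mul, one_div_mul_cancel hBi']
  have hpw0 : ∀ s t, 0 ≤ T.p t * w t s := fun s t => mul_nonneg (T.p_nonneg t) (hw0 t s)
  have hpw : ∀ s, Summable fun t => T.p t * w t s := fun s =>
    T.p_sum.summable.of_nonneg_of_le (hpw0 s) fun t =>
      mul_le_of_le_one_right (T.p_nonneg t) ((Finset.single_le_sum (f := w t)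
        (fun s _ => hw0 t s) (Finset.mem_univ s)).trans_eq (hw1 t))
  set c : Strategy A X A' X' → ℝ := fun s => ∑' t, T.p t * w t s with hc
  have hcs : ∀ s, HasSum (fun t => T.p t * w t s) (c s) := fun s => (hpw s).hasSum
  have hc1 : ∑ s, c s = 1 := by
    refine (hasSum_sum fun s _ => hcs s).unique ?_
    simp_rw [← Finset.mul_sum, hw1, mul_one]
    exact T.p_sum
  choose Jξ hJ using fun s => summable_smul_of_posSemidef hK hKtr (hpw s) (hpw0 s)
  have hJpos : ∀ s, (Jξ s).PosSemidef := fun s => posSemidef_of_hasSum (hJ s) fun t =>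
    (hK t).smul (Complex.zero_le_real.2 (hpw0 s t))
  have hsnd : ∀ s, HasSum (fun t => ((T.p t * w t s : ℝ) : ℂ) • traceSnd (K t))
      (traceSnd (Jξ s)) := fun s => by
    simpa only [map_smul, traceSndLinear_apply] using hasSum_map_matrix (traceSndLinear _ _) (hJ s)
  have hsnd2 : ∀ s, HasSum (fun t => ((T.p t * w t s : ℝ) : ℂ) • traceSnd (traceSnd (K t)))
      (traceSnd (traceSnd (Jξ s))) := fun s => by
    simpa only [map_smul, traceSndLinear_apply] using hasSum_map_matrix (traceSndLinear _ _) (hsnd s)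
  -- Both sides are sums of one series, since the identity holds for each single comb.
  have hsig : ∀ s, traceSnd (Jξ s) =
      traceSnd (traceSnd (Jξ s)) ⊗ₖ ((1 / (Fintype.card Bo : ℂ)) • (1 : Matrix Bo Bo ℂ)) := by
    intro s
    refine (hsnd s).unique (hasSum_matrix_iff.2 fun i j => ?_)
    have h := (hasSum_matrix_iff.1 (hsnd2 s) i.1 j.1).mul_right
      (((1 / (Fintype.card Bo : ℂ)) • (1 : Matrix Bo Bo ℂ)) i.2 j.2)
    refine h.congr_fun ?_
    intro t
    have h2 := congrFun (congrFun (hKsig t) i) j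
    rw [Matrix.kroneckerMap_apply] at h2
    rw [Matrix.smul_apply, Matrix.smul_apply, h2, smul_mul_assoc]
  have hfst : ∀ s, traceFst (traceSnd (traceSnd (Jξ s))) =
      ((c s : ℂ) * (1 / (Fintype.card Bi' : ℂ))) • (1 : Matrix Bi' Bi' ℂ) := by
    intro s
    have h := hasSum_map_matrix (traceFstLinear _ _) (hsnd2 s)
    simp only [map_smul, traceFstLinear_apply] at h
    refine h.unique ?_
    have h2 := (Complex.hasSum_ofReal.2 (hcs s)).smul_const
      ((1 / (Fintype.card Bi' : ℂ)) • (1 : Matrix Bi' Bi' ℂ))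
    rw [smul_smul] at h2
    refine h2.congr_fun fun t => ?_
    rw [← hKfst t]
  have hout : ∀ s, traceOutputs (Jξ s) = ((c s : ℂ) * (1 / (Fintype.card Bi' : ℂ)) *
      (1 / (Fintype.card Bo : ℂ))) • (1 : Matrix (Bi' × Bo) (Bi' × Bo) ℂ) := fun s =>
    traceOutputs_of_traceSnd (hsig s) (hfst s)
  have hc1' : ∑ s, (c s : ℂ) = 1 := by rw [← Complex.ofReal_sum, hc1, Complex.ofReal_one]
  refine ⟨Jξ, fun s => traceSnd (traceSnd (Jξ s)), hJpos, fun s => ⟨_, hout s⟩, ?_,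
    fun s => posSemidef_traceSnd (posSemidef_traceSnd (hJpos s)), fun s => ⟨_, hfst s⟩, ?_, hsig,
    fun a' x' => ?_⟩
  · simp_rw [hout, ← Finset.sum_smul, ← Finset.sum_mul, hc1']
    congr 1
    field_simp
  · simp_rw [hfst, ← Finset.sum_smul, ← Finset.sum_mul, hc1', one_mul]
  · have hlhs : HasSum (fun t => ∑ a, ∑ x, ((T.p t * T.alice t a' x a x' : ℝ) : ℂ) •
        choi (T.post t ∘ₗ ampl (Fin T.dimS) (I a x) ∘ₗ T.pre t)) (choi (I' a' x')) := by
      refine hasSum_matrix_iff.2 fun p q => ?_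
      rw [choi_apply]
      refine ((hasSum_matrix_iff.1 (hT a' x' (Matrix.single p.2 q.2 1)) p.1 q.1).mul_left
        _).congr_fun fun t => ?_
      simp only [Matrix.sum_apply, Matrix.smul_apply, choi_apply, Finset.mul_sum,
        LinearMap.comp_apply, smul_eq_mul]
      refine Finset.sum_congr rfl fun a _ => Finset.sum_congr rfl fun x _ => ?_
      ring
    have hrhs : HasSum (fun t => ∑ s : Strategy A X A' X', ∑ a, ∑ x,
        (Strategy.dOut s a' a x' * Strategy.dIn s x x') • ((T.p t * w t s : ℝ) : ℂ) •
          choi (T.post t ∘ₗ ampl (Fin T.dimS) (I a x) ∘ₗ T.pre t))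
        (∑ s : Strategy A X A' X', ∑ a, ∑ x,
          (Strategy.dOut s a' a x' * Strategy.dIn s x x') • link (choi (I a x)) (Jξ s)) := by
      refine hasSum_sum fun s _ => hasSum_sum fun a _ => hasSum_sum fun x _ => ?_
      refine HasSum.const_smul _ ?_
      have h := hasSum_map_matrix (linkLinear (choi (I a x))) (hJ s)
      simpa only [map_smul, linkLinear_apply, hKdef, link_choi_combOp] using h
    refine hlhs.unique (hrhs.congr_fun fun t => ?_)
    symm
    -- Summing over s first turns the deterministic strategies, weighted by w, back into Alice's
    -- distribution.
    rw [Finset.sum_comm]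
    refine Finset.sum_congr rfl fun a _ => ?_
    rw [Finset.sum_comm]
    refine Finset.sum_congr rfl fun x _ => ?_
    simp_rw [smul_smul, ← Finset.sum_smul]
    congr 1
    rw [← hw t a' x a x', Finset.mul_sum, Complex.ofReal_sum]
    refine Finset.sum_congr rfl fun s _ => ?_
    simp only [Strategy.dOut, Strategy.dIn]
    split_ifs <;> push_cast <;> ring

end Conversion

/-! ### From a solution of the program to an LOSR operation -/

section Feasibility

variable {A X A' X' Bi Bo Bi' Bo' : Type*}
    [Fintype A] [DecidableEq A] [Fintype X] [DecidableEq X]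
    [Fintype A'] [DecidableEq A'] [Fintype X'] [DecidableEq X']
    [Fintype Bi] [DecidableEq Bi] [Nonempty Bi] [Fintype Bo] [DecidableEq Bo] [Nonempty Bo]
    [Fintype Bi'] [DecidableEq Bi'] [Nonempty Bi'] [Fintype Bo'] [DecidableEq Bo'] [Nonempty Bo']
    {I : A → X → Matrix Bi Bi ℂ →ₗ[ℂ] Matrix Bo Bo ℂ}
    {I' : A' → X' → Matrix Bi' Bi' ℂ →ₗ[ℂ] Matrix Bo' Bo' ℂ}

lemma choi_injective {n m : Type*} [Fintype n] [DecidableEq n] [Nonempty n]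
    {Φ Ψ : Matrix n n ℂ →ₗ[ℂ] Matrix m m ℂ} (h : choi Φ = choi Ψ) : Φ = Ψ := by
  have hn : (1 / (Fintype.card n : ℂ)) ≠ 0 :=
    one_div_ne_zero (Nat.cast_ne_zero.2 Fintype.card_ne_zero)
  have hs : ∀ i j, Φ (Matrix.single i j 1) = Ψ (Matrix.single i j 1) := fun i j => by
    ext b c
    have h2 := congrFun (congrFun h (b, i)) (c, j)
    rw [choi_apply, choi_apply] at h2
    exact mul_left_cancel₀ hn h2
  refine LinearMap.ext fun M => ?_
  rw [map_eq_sum_single Φ, map_eq_sum_single Ψ]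
  simp_rw [hs]

/-- The solution index s itself becomes the shared variable, with Bob's channels realising `Jξ s`
and the scalar factor t s as its probability. -/
lemma SDPFeasible.losrConvertible
    (h : SDPFeasible (fun a x => choi (I a x)) (fun a' x' => choi (I' a' x'))) :
    LOSRConvertible I I' := by
  obtain ⟨Jξ, JF, h⟩ := h
  have hBo : (Fintype.card Bo : ℂ) ≠ 0 := Nat.cast_ne_zero.2 Fintype.card_ne_zero
  have hBi' : (Fintype.card Bi' : ℂ) ≠ 0 := Nat.cast_ne_zero.2 Fintype.card_ne_zero
  choose c hc using h.F_prop
  choose t pre post ht0 hpre hpost hJ using fun s =>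
    exists_smul_combOp (h.F_pos s) (hc s) (h.ξ_pos s) (h.no_signalling s)
  -- A `combOp` of channels satisfies the output trace condition with constant 1/(d_{B_out}
  -- d_{B'_in'}), so the trace of `ξ_sum` compares ∑ t with 1.
  have ht1 : ∑ s, t s = 1 := by
    have hout : ∀ s, traceOutputs (Jξ s) = ((t s : ℂ) * (1 / (Fintype.card Bi' : ℂ) *
        (1 / (Fintype.card Bo : ℂ)))) • (1 : Matrix (Bi' × Bo) (Bi' × Bo) ℂ) := fun s => by
      rw [← mul_assoc]
      refine traceOutputs_of_traceSnd (F := (t s : ℂ) • combMarginal (pre s)) ?_ ?_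
      · rw [hJ, traceSnd_smul, traceSnd_combOp _ (hpost s).2, Matrix.smul_kronecker]
      · rw [mul_smul, ← traceFst_combMarginal (hpre s).2]
        exact map_smul (traceFstLinear _ _) _ _
    have hsum := h.ξ_sum
    simp_rw [hout, ← Finset.sum_smul, ← Finset.sum_mul] at hsum
    have h0 := congrArg Matrix.trace hsum
    rw [Matrix.trace_smul, Matrix.trace_smul, Matrix.trace_one, Fintype.card_prod, smul_eq_mul,
      smul_eq_mul] at h0
    push_cast at h0
    field_simp at h0
    exact_mod_cast h0
  -- Strategies may live in a higher universe, while `Lam` is in `Type`; hence the relabelling by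
  -- `Fin`.
  let e := Fintype.equivFin (Strategy A X A' X')
  let T : LOSROperation A X A' X' Bi Bo Bi' Bo' :=
    { Lam := Fin (Fintype.card (Strategy A X A' X'))
      countable_Lam := inferInstance
      p := fun l => t (e.symm l)
      p_nonneg := fun l => ht0 _
      p_sum := by
        rw [← ht1, ← e.symm.sum_comp]
        exact hasSum_fintype _
      alice := fun l a' x a x' =>
        (if (e.symm l).1 a x' = a' then 1 else 0) * (if (e.symm l).2 x' = x then 1 else 0)
      alice_nonneg := fun l a' x a x' => by positivity
      alice_sum := fun l a x' => by simp
      alice_noRetro := fun l x x' a₁ a₂ => by simp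
      dimS := Fintype.card (Bi × Bi')
      pre := fun l => pre (e.symm l)
      pre_cptp := fun l => hpre _
      post := fun l => post (e.symm l)
      post_cptp := fun l => hpost _ }
  refine ⟨T, fun a' x' ρ => ?_⟩
  have hI : I' a' x' = ∑ s : Strategy A X A' X', ∑ a, ∑ x,
      ((t s * ((if s.1 a x' = a' then 1 else 0) * (if s.2 x' = x then 1 else 0)) : ℝ) : ℂ) •
        (post s ∘ₗ ampl (Fin (Fintype.card (Bi × Bi'))) (I a x) ∘ₗ pre s) := by
    refine choi_injective ?_
    rw [h.decomp a' x']
    ext p q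
    simp only [choi_apply, LinearMap.sum_apply, LinearMap.smul_apply, Matrix.sum_apply,
      Matrix.smul_apply, Finset.mul_sum, smul_eq_mul]
    refine Finset.sum_congr rfl fun s _ => Finset.sum_congr rfl fun a _ =>
      Finset.sum_congr rfl fun x _ => ?_
    rw [hJ s, ← linkLinear_apply, map_smul, linkLinear_apply, link_choi_combOp,
      Matrix.smul_apply, choi_apply, smul_eq_mul]
    simp only [Strategy.dOut, Strategy.dIn]
    split_ifs <;> push_cast <;> ring
  have hsum : I' a' x' ρ = ∑ l : Fin (Fintype.card (Strategy A X A' X')), ∑ a, ∑ x,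
      ((T.p l * T.alice l a' x a x' : ℝ) : ℂ) •
        T.post l (ampl (Fin T.dimS) (I a x) (T.pre l ρ)) := by
    rw [hI, ← e.symm.sum_comp]
    simp only [LinearMap.sum_apply, LinearMap.smul_apply, LinearMap.comp_apply]
    rfl
  rw [hsum]
  exact hasSum_fintype _

end Feasibility

end ChannelEPR

end

theorem mainTheorem1 {A X A' X' Bi Bo Bi' Bo' : Type*}
    [Fintype A] [DecidableEq A] [Nonempty A] [Fintype X] [DecidableEq X] [Nonempty X]
    [Fintype A'] [DecidableEq A'] [Nonempty A'] [Fintype X'] [DecidableEq X'] [Nonempty X']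
    [Fintype Bi] [DecidableEq Bi] [Nonempty Bi] [Fintype Bo] [DecidableEq Bo] [Nonempty Bo]
    [Fintype Bi'] [DecidableEq Bi'] [Nonempty Bi'] [Fintype Bo'] [DecidableEq Bo'] [Nonempty Bo']
    (I : A → X → Matrix Bi Bi ℂ →ₗ[ℂ] Matrix Bo Bo ℂ)
    (I' : A' → X' → Matrix Bi' Bi' ℂ →ₗ[ℂ] Matrix Bo' Bo' ℂ)
    (hI : ChannelEPR.IsChannelAssemblage I) (hI' : ChannelEPR.IsChannelAssemblage I') :
    ChannelEPR.LOSRConvertible I I' ↔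
      ChannelEPR.SDPFeasible (fun a x => ChannelEPR.choi (I a x))
        (fun a' x' => ChannelEPR.choi (I' a' x')) := by
  exact ⟨fun h => h.sdpFeasible, fun h => h.losrConvertible⟩
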